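/- Let $G$ be a finitely generated (discrete) group which is virtually abelian of rank $m$, i.e. $G$ contains a subgroup of finite index isomorphic to $\mathbb{Z}^m$, and suppose that $m \ge 3$. Then $G$ is not matricially stable. Here $G$ is called matricially stable if its full group $C^*$-algebra $C^*(G)$ is matricially weakly semiprojective: for every sequence of matrix algebras $M_{k_1}(\mathbb{C}), M_{k_2}(\mathbb{C}), \ldots$ (with $k_n \ge 1$) and every $*$-homomorphism $\varphi \colon C^*(G) \to \prod_n M_{k_n}(\mathbb{C}) / \bigoplus_n M_{k_n}(\mathbb{C})$ there is a $*$-homomorphism $\psi \colon C^*(G) \to \prod_n M_{k_n}(\mathbb{C})$ with $\rho \circ \psi = \varphi$, where $\prod_n M_{k_n}(\mathbb{C})$ is the $C^*$-algebra of bounded sequences (for the operator norms), $\bigoplus_n M_{k_n}(\mathbb{C})$ is its ideal of sequences tending to $0$ in norm, and $\rho$ is the quotient map. -/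

import Mathlib

noncomputable section

namespace GroupStability

open Filter Topology UniformSpace
open scoped ENNReal Matrix.Norms.L2Operator ComplexConjugate

universe u

/-! ### The complex group algebra as a `*`-algebra -/

section GroupAlgebra

variable {G : Type u} [Group G]

/-- The involution of the group algebra `ℂ[G]`:
`(∑ c_g g)^* = ∑ (conj c_g) g⁻¹`. -/
instance instStarGroupAlgebra : Star (MonoidAlgebra ℂ G) where
  star a := a.coeff.sum fun g c => MonoidAlgebra.single g⁻¹ (conj c)

theorem star_groupAlgebra_def (a : MonoidAlgebra ℂ G) :
    star a = a.coeff.sum fun g c => MonoidAlgebra.single g⁻¹ (conj c) := rfl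

@[simp]
theorem star_single (g : G) (c : ℂ) :
    star (MonoidAlgebra.single g c) = MonoidAlgebra.single g⁻¹ (conj c) := by
  rw [star_groupAlgebra_def]
  simp

theorem star_groupAlgebra_add (a b : MonoidAlgebra ℂ G) : star (a + b) = star a + star b := by
  simp only [star_groupAlgebra_def, MonoidAlgebra.coeff_add]
  exact Finsupp.sum_add_index' (by simp) (by simp)

instance instStarRingGroupAlgebra : StarRing (MonoidAlgebra ℂ G) where
  star_involutive a := by
    induction a using MonoidAlgebra.induction_linear with
    | zero => simp [star_groupAlgebra_def]
    | add a b ha hb => rw [star_groupAlgebra_add, star_groupAlgebra_add, ha, hb]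
    | single g c => simp
  star_mul a b := by
    induction a using MonoidAlgebra.induction_linear with
    | zero => simp [star_groupAlgebra_def]
    | add a a' ha ha' => rw [add_mul, star_groupAlgebra_add, ha, ha', star_groupAlgebra_add, mul_add]
    | single g c =>
      induction b using MonoidAlgebra.induction_linear with
      | zero => simp [star_groupAlgebra_def]
      | add b b' hb hb' =>
        rw [mul_add, star_groupAlgebra_add, hb, hb', star_groupAlgebra_add, add_mul]
      | single h d => simp [MonoidAlgebra.single_mul_single, mul_comm]
  star_add := star_groupAlgebra_add

instance instStarModuleGroupAlgebra : StarModule ℂ (MonoidAlgebra ℂ G) where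
  star_smul c a := by
    induction a using MonoidAlgebra.induction_linear with
    | zero => simp
    | add a b ha hb => rw [smul_add, star_add, ha, hb, star_add, smul_add]
    | single g d => simp

end GroupAlgebra

/-! ### The full group C*-algebra -/

section GroupCStar

variable {G : Type u} [Group G]

/-- A C*-seminorm on `ℂ[G]`: a submultiplicative seminorm with the C*-identity. -/
structure IsCStarSeminorm (p : Seminorm ℂ (MonoidAlgebra ℂ G)) : Prop where
  mul_le : ∀ a b, p (a * b) ≤ p a * p b
  star_mul_self : ∀ a, p (star a * a) = p a * p a

theorem isCStarSeminorm_zero : IsCStarSeminorm (0 : Seminorm ℂ (MonoidAlgebra ℂ G)) where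
  mul_le a b := by simp
  star_mul_self a := by simp

theorem IsCStarSeminorm.apply_single_le {p : Seminorm ℂ (MonoidAlgebra ℂ G)}
    (hp : IsCStarSeminorm p) (g : G) (c : ℂ) : p (MonoidAlgebra.single g c) ≤ ‖c‖ := by
  have h1 : p 1 ≤ 1 := by
    have := hp.star_mul_self 1
    rw [star_one, one_mul] at this
    nlinarith [apply_nonneg p 1]
  have h2 : p (MonoidAlgebra.single g 1) ≤ 1 := by
    have h := hp.star_mul_self (MonoidAlgebra.single g 1)
    rw [star_single, MonoidAlgebra.single_mul_single] at h
    simp only [inv_mul_cancel, map_one, one_mul, ← MonoidAlgebra.one_def] at h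
    nlinarith [apply_nonneg p (MonoidAlgebra.single g 1)]
  have h3 : MonoidAlgebra.single g c = c • MonoidAlgebra.single g (1 : ℂ) := by simp
  rw [h3, map_smul_eq_mul]
  exact mul_le_of_le_one_right (norm_nonneg c) h2

theorem IsCStarSeminorm.apply_le {p : Seminorm ℂ (MonoidAlgebra ℂ G)}
    (hp : IsCStarSeminorm p) (a : MonoidAlgebra ℂ G) :
    p a ≤ ∑ g ∈ a.coeff.support, ‖a.coeff g‖ := by
  have h : a = ∑ g ∈ a.coeff.support, MonoidAlgebra.single g (a.coeff g) :=
    (MonoidAlgebra.sum_coeff_single a).symm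
  calc p a = p (∑ g ∈ a.coeff.support, MonoidAlgebra.single g (a.coeff g)) := by rw [← h]
    _ ≤ ∑ g ∈ a.coeff.support, p (MonoidAlgebra.single g (a.coeff g)) :=
        Finset.le_sum_of_subadditive p (map_zero p).le (map_add_le_add p) _ _
    _ ≤ _ := Finset.sum_le_sum fun g _ => hp.apply_single_le g _

/-- The universal norm on `ℂ[G]`: the largest C*-seminorm, that is
`‖a‖ = sup {p a : p a C*-seminorm on ℂ[G]}`. The supremum is finite, because every C*-seminorm is
at most the `ℓ¹`-norm. -/
def universalNorm (a : MonoidAlgebra ℂ G) : ℝ :=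
  sSup {r : ℝ | ∃ p : Seminorm ℂ (MonoidAlgebra ℂ G), IsCStarSeminorm p ∧ r = p a}

theorem IsCStarSeminorm.le_universalNorm {p : Seminorm ℂ (MonoidAlgebra ℂ G)}
    (hp : IsCStarSeminorm p) (a : MonoidAlgebra ℂ G) : p a ≤ universalNorm a :=
  le_csSup ⟨∑ g ∈ a.coeff.support, ‖a.coeff g‖, by rintro _ ⟨q, hq, rfl⟩; exact hq.apply_le a⟩
    ⟨p, hp, rfl⟩

theorem universalNorm_le {a : MonoidAlgebra ℂ G} {r : ℝ}
    (h : ∀ p : Seminorm ℂ (MonoidAlgebra ℂ G), IsCStarSeminorm p → p a ≤ r) :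
    universalNorm a ≤ r :=
  csSup_le ⟨_, 0, isCStarSeminorm_zero, rfl⟩ (by rintro _ ⟨q, hq, rfl⟩; exact h q hq)

theorem universalNorm_nonneg (a : MonoidAlgebra ℂ G) : 0 ≤ universalNorm a :=
  isCStarSeminorm_zero.le_universalNorm a

/-- The universal norm as a seminorm. -/
def universalSeminorm (G : Type u) [Group G] : Seminorm ℂ (MonoidAlgebra ℂ G) :=
  Seminorm.ofSMulLE universalNorm
    (le_antisymm (universalNorm_le fun p _ => by simp) (universalNorm_nonneg 0))
    (fun a b => universalNorm_le fun p hp => (map_add_le_add p a b).trans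
      (add_le_add (hp.le_universalNorm a) (hp.le_universalNorm b)))
    (fun c a => universalNorm_le fun p hp => by
      rw [map_smul_eq_mul]
      exact mul_le_mul_of_nonneg_left (hp.le_universalNorm a) (norm_nonneg c))

theorem universalSeminorm_apply (a : MonoidAlgebra ℂ G) :
    universalSeminorm G a = universalNorm a := rfl

theorem isCStarSeminorm_universalSeminorm : IsCStarSeminorm (universalSeminorm G) where
  mul_le a b := universalNorm_le fun p hp => (hp.mul_le a b).trans
    (mul_le_mul (hp.le_universalNorm a) (hp.le_universalNorm b) (apply_nonneg p b)
      (universalNorm_nonneg a))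
  star_mul_self a := by
    simp only [universalSeminorm_apply]
    refine le_antisymm (universalNorm_le fun p hp => ?_) ?_
    · rw [hp.star_mul_self]
      exact mul_self_le_mul_self (apply_nonneg p a) (hp.le_universalNorm a)
    · have h : universalNorm a ≤ √(universalNorm (star a * a)) := universalNorm_le fun p hp =>
        Real.le_sqrt_of_sq_le (by
          rw [sq, ← hp.star_mul_self]
          exact hp.le_universalNorm _)
      rw [← sq]
      exact (Real.le_sqrt (universalNorm_nonneg a) (universalNorm_nonneg _)).1 h

/-- The group algebra, normed by the universal norm. -/
instance instSeminormedRingGroupAlgebra : SeminormedRing (MonoidAlgebra ℂ G) where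
  __ := (inferInstance : Ring (MonoidAlgebra ℂ G))
  __ := (universalSeminorm G).toAddGroupSeminorm.toSeminormedAddCommGroup
  norm_mul_le := isCStarSeminorm_universalSeminorm.mul_le

theorem norm_groupAlgebra_def (a : MonoidAlgebra ℂ G) : ‖a‖ = universalNorm a := rfl

instance instNormedAlgebraGroupAlgebra : NormedAlgebra ℂ (MonoidAlgebra ℂ G) where
  norm_smul_le c a := (map_smul_eq_mul (universalSeminorm G) c a).le

theorem norm_star_mul_self_groupAlgebra (a : MonoidAlgebra ℂ G) :
    ‖star a * a‖ = ‖a‖ * ‖a‖ :=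
  isCStarSeminorm_universalSeminorm.star_mul_self a

theorem norm_star_groupAlgebra (a : MonoidAlgebra ℂ G) : ‖star a‖ = ‖a‖ := by
  have key : ∀ b : MonoidAlgebra ℂ G, ‖b‖ ≤ ‖star b‖ := by
    intro b
    have h := norm_mul_le (star b) b
    rw [norm_star_mul_self_groupAlgebra] at h
    rcases (norm_nonneg b).eq_or_lt with h' | h'
    · rw [← h']; exact norm_nonneg _
    · exact le_of_mul_le_mul_right h h'
  refine le_antisymm ?_ (key a)
  simpa using key (star a)

instance instNormedStarGroupGroupAlgebra : NormedStarGroup (MonoidAlgebra ℂ G) where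
  norm_star_le a := (norm_star_groupAlgebra a).le

/-- The full group C*-algebra `C*(G)` of a discrete group `G`: the (Hausdorff) completion of `ℂ[G]`
in the largest C*-seminorm. -/
abbrev GroupCStarAlgebra (G : Type u) [Group G] : Type u := Completion (MonoidAlgebra ℂ G)

theorem uniformContinuous_star_groupAlgebra :
    UniformContinuous (star : MonoidAlgebra ℂ G → MonoidAlgebra ℂ G) :=
  AddMonoidHomClass.uniformContinuous_of_bound (starAddEquiv : MonoidAlgebra ℂ G ≃+ _) 1
    fun a => by simp

/-- The involution of `C*(G)`, the continuous extension of the involution of `ℂ[G]`. -/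
instance instStarGroupCStarAlgebra : Star (GroupCStarAlgebra G) where
  star := Completion.map star

theorem star_coe (a : MonoidAlgebra ℂ G) :
    star (a : GroupCStarAlgebra G) = ((star a : MonoidAlgebra ℂ G) : GroupCStarAlgebra G) :=
  Completion.map_coe uniformContinuous_star_groupAlgebra a

theorem continuous_star_groupCStarAlgebra :
    Continuous (star : GroupCStarAlgebra G → GroupCStarAlgebra G) :=
  Completion.continuous_map

instance instStarRingGroupCStarAlgebra : StarRing (GroupCStarAlgebra G) where
  star_involutive x := by
    have hc := continuous_star_groupCStarAlgebra (G := G)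
    induction x using Completion.induction_on with
    | hp => exact isClosed_eq (hc.comp hc) continuous_id
    | ih a => rw [star_coe, star_coe, star_star]
  star_mul x y := by
    have hc := continuous_star_groupCStarAlgebra (G := G)
    induction x, y using Completion.induction_on₂ with
    | hp =>
      exact isClosed_eq (hc.comp continuous_mul)
        ((hc.comp continuous_snd).mul (hc.comp continuous_fst))
    | ih a b => rw [← Completion.coe_mul, star_coe, star_coe, star_coe, star_mul, Completion.coe_mul]
  star_add x y := by
    have hc := continuous_star_groupCStarAlgebra (G := G)
    induction x, y using Completion.induction_on₂ with
    | hp =>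
      exact isClosed_eq (hc.comp continuous_add)
        ((hc.comp continuous_fst).add (hc.comp continuous_snd))
    | ih a b => rw [← Completion.coe_add, star_coe, star_coe, star_coe, star_add, Completion.coe_add]

instance instCStarAlgebraGroupCStarAlgebra : CStarAlgebra (GroupCStarAlgebra G) where
  norm_smul_le := norm_smul_le
  norm_mul_self_le x := by
    have hc := continuous_star_groupCStarAlgebra (G := G)
    induction x using Completion.induction_on with
    | hp =>
      exact isClosed_le (continuous_norm.mul continuous_norm)
        (continuous_norm.comp (hc.mul continuous_id))
    | ih a =>
      rw [star_coe, ← Completion.coe_mul, Completion.norm_coe, Completion.norm_coe,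
        norm_star_mul_self_groupAlgebra]
  star_smul c x := by
    have hc := continuous_star_groupCStarAlgebra (G := G)
    induction x using Completion.induction_on with
    | hp =>
      exact isClosed_eq (hc.comp (continuous_const_smul c)) (hc.const_smul (star c))
    | ih a => rw [← Completion.coe_smul, star_coe, star_coe, star_smul, Completion.coe_smul]

end GroupCStar

/-! ### Bounded products of matrix algebras modulo their `c₀`-sums -/

section MatrixSequences

variable (k : ℕ → ℕ) [∀ n, NeZero (k n)]

/-- `∏ₙ M_{k n}(ℂ)`: the C*-algebra of norm-bounded sequences of matrices, where each `M_{k n}(ℂ)`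
has its C*-norm (the operator norm on the Hilbert space `ℂ^(k n)`), with the supremum norm. -/
abbrev MatrixProd : Type := lp (fun n => Matrix (Fin (k n)) (Fin (k n)) ℂ) ∞

instance instCStarAlgebraMatrixProd : CStarAlgebra (MatrixProd k) where
  __ := (inferInstance : NormedRing (MatrixProd k))
  __ := (inferInstance : NonUnitalCStarAlgebra (MatrixProd k))
  __ := (inferInstance : NormedAlgebra ℂ (MatrixProd k))

/-- `⨁ₙ M_{k n}(ℂ)`: the closed ideal of the sequences in `∏ₙ M_{k n}(ℂ)` with norms tending to
zero. -/
def matrixSum : Ideal (MatrixProd k) where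
  carrier := {x | Tendsto (fun n => ‖x n‖) atTop (𝓝 0)}
  zero_mem' := by simp
  add_mem' {x y} hx hy := by
    refine squeeze_zero (fun n => norm_nonneg _) (fun n => ?_) (by simpa using hx.add hy)
    exact norm_add_le (x n) (y n)
  smul_mem' c x hx := by
    refine squeeze_zero (fun n => norm_nonneg _) (fun n => ?_) (by simpa using hx.const_mul ‖c‖)
    exact (norm_mul_le (c n) (x n)).trans
      (mul_le_mul_of_nonneg_right (lp.norm_apply_le_norm ENNReal.top_ne_zero c n) (norm_nonneg _))

theorem mem_matrixSum {x : MatrixProd k} :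
    x ∈ matrixSum k ↔ Tendsto (fun n => ‖x n‖) atTop (𝓝 0) := Iff.rfl

instance instIsTwoSidedMatrixSum : (matrixSum k).IsTwoSided where
  mul_mem_of_left {x} c hx := by
    refine squeeze_zero (fun n => norm_nonneg _) (fun n => ?_)
      (by simpa using ((mem_matrixSum k).1 hx).mul_const ‖c‖)
    exact (norm_mul_le (x n) (c n)).trans
      (mul_le_mul_of_nonneg_left (lp.norm_apply_le_norm ENNReal.top_ne_zero c n) (norm_nonneg _))

theorem star_mem_matrixSum {x : MatrixProd k} (hx : x ∈ matrixSum k) : star x ∈ matrixSum k := by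
  rw [mem_matrixSum] at hx ⊢
  simpa using hx

/-- The quotient C*-algebra `∏ₙ M_{k n}(ℂ) / ⨁ₙ M_{k n}(ℂ)` as a `*`-algebra. -/
def MatrixCorona : Type := MatrixProd k ⧸ matrixSum k

instance instRingMatrixCorona : Ring (MatrixCorona k) :=
  Ideal.Quotient.ring (matrixSum k)

instance instAlgebraMatrixCorona : Algebra ℂ (MatrixCorona k) :=
  Ideal.Quotient.algebra ℂ (I := matrixSum k)

/-- The natural quotient map as a homomorphism of algebras. -/
def coronaMk : MatrixProd k →ₐ[ℂ] MatrixCorona k := Ideal.Quotient.mkₐ ℂ (matrixSum k)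

theorem coronaMk_surjective : Function.Surjective (coronaMk k) :=
  Ideal.Quotient.mk_surjective

theorem coronaMk_eq_iff {x y : MatrixProd k} : coronaMk k x = coronaMk k y ↔
    Tendsto (fun n => ‖x n - y n‖) atTop (𝓝 0) :=
  Ideal.Quotient.eq

/-- The involution of the quotient: `[x]^* = [x^*]`. -/
instance instStarMatrixCorona : Star (MatrixCorona k) where
  star := Quotient.map' star fun x y h => by
    rw [Submodule.quotientRel_def] at h ⊢
    simpa using star_mem_matrixSum k h

theorem star_coronaMk (x : MatrixProd k) : star (coronaMk k x) = coronaMk k (star x) := rfl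

instance instStarRingMatrixCorona : StarRing (MatrixCorona k) where
  star_involutive x := by
    obtain ⟨x, rfl⟩ := coronaMk_surjective k x
    rw [star_coronaMk, star_coronaMk, star_star]
  star_mul x y := by
    obtain ⟨x, rfl⟩ := coronaMk_surjective k x
    obtain ⟨y, rfl⟩ := coronaMk_surjective k y
    rw [← map_mul, star_coronaMk, star_coronaMk, star_coronaMk, star_mul, map_mul]
  star_add x y := by
    obtain ⟨x, rfl⟩ := coronaMk_surjective k x
    obtain ⟨y, rfl⟩ := coronaMk_surjective k y
    rw [← map_add, star_coronaMk, star_coronaMk, star_coronaMk, star_add, map_add]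

/-- The natural quotient map `∏ₙ M_{k n}(ℂ) → ∏ₙ M_{k n}(ℂ) / ⨁ₙ M_{k n}(ℂ)` as a
`*`-homomorphism. -/
def coronaMap : MatrixProd k →⋆ₙₐ[ℂ] MatrixCorona k where
  toFun := coronaMk k
  map_smul' c x := map_smul (coronaMk k) c x
  map_zero' := map_zero (coronaMk k)
  map_add' := map_add (coronaMk k)
  map_mul' := map_mul (coronaMk k)
  map_star' _ := rfl

end MatrixSequences

/-! ### Matricial stability -/

/-- A (separable) C*-algebra `A` is matricially weakly semiprojective if every `*`-homomorphism
`A → ∏ₙ M_{k n}(ℂ) / ⨁ₙ M_{k n}(ℂ)` lifts to a `*`-homomorphism `A → ∏ₙ M_{k n}(ℂ)`, for all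
sequences `(k n)` of positive integers. The `*`-homomorphisms need not be unital. -/
def MatriciallyWeaklySemiprojective (A : Type u) [NonUnitalCStarAlgebra A] : Prop :=
  ∀ (k : ℕ → ℕ) [∀ n, NeZero (k n)] (φ : A →⋆ₙₐ[ℂ] MatrixCorona k),
    ∃ ψ : A →⋆ₙₐ[ℂ] MatrixProd k, (coronaMap k).comp ψ = φ

/-- A (countable) discrete group `G` is matricially stable if its full group C*-algebra is
matricially weakly semiprojective. -/
def MatriciallyStable (G : Type u) [Group G] : Prop :=
  MatriciallyWeaklySemiprojective (GroupCStarAlgebra G)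

/-- `G` is virtually abelian of rank `m`: it has a subgroup of finite index isomorphic to `ℤ^m`. -/
def IsVirtuallyAbelianOfRank (G : Type u) [Group G] (m : ℕ) : Prop :=
  ∃ H : Subgroup G, H.FiniteIndex ∧ Nonempty (H ≃* Multiplicative (Fin m → ℤ))

end GroupStability

end

noncomputable section

namespace GroupStability

open Filter Topology UniformSpace
open scoped ENNReal Matrix.Norms.L2Operator ComplexConjugate

universe u

/-! ### The corona as a normed algebra -/

section CoronaNorm

variable (k : ℕ → ℕ) [∀ n, NeZero (k n)]

/-! The proof builds a representation of `G` in a corona and shows, by a dimension count, that it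
has no lift. Let `A` be a normal subgroup of finite index, embedded in `ℤ^m`. The three normalized
spin operators in dimension `n + 2` have commutators of norm `O(1/n)`, so their Cayley transforms
give three sequences of unitaries, close to 1, which commute in the corona
(`exists_spin_unitaries`). Three coordinates of `ℤ^m` are used as exponents; twisting by an
injective character `χ` gives an asymptotic representation of `A`, and `inducedRep` carries it to
`G`.

The obstruction is the quadratic form of `[[D, K], [Kᴴ, -D]]`. If `D` is self-adjoint and commutes
with `K`, the form is nonpositive on a subspace of half the dimension (`exists_pairForm_nonpos`).
For the spin operators it is the form of `σ·J / j`, which is the identity on the top component of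
the tensor product with `ℂ²`; that component exceeds half the dimension by one (`pairForm_spin`,
`lt_finrank_spinSubspace`).

The induced representation also contains conjugates of the representation of `A`, whose blocks might
cancel this excess. Here `χ` helps. `D` and `K` are formed in `ℂ[G]` from elements of `A` normalized
by values of `χ`, and `D` contains a large multiple of their deviation from 1. On blocks where
conjugation fixes these elements, the spin form appears; on every other block `D` is close to a
scalar at least 1, and the form is positive on half the dimension (`exists_unitaries_positive`). In
total it is positive on more than half, whereas a lift would make `D` and `K` commute exactly
(`coronaMk_blockSeq_ne_of_commute`). -/

theorem isClosed_matrixSum : IsClosed (matrixSum k : Set (MatrixProd k)) := by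
  refine isClosed_of_closure_subset fun x hx => ?_
  rw [SetLike.mem_coe, mem_matrixSum, Metric.tendsto_atTop]
  intro ε hε
  obtain ⟨y, hy, hxy⟩ := Metric.mem_closure_iff.1 hx (ε / 2) (half_pos hε)
  obtain ⟨N, hN⟩ := Metric.tendsto_atTop.1 ((mem_matrixSum k).1 hy) (ε / 2) (half_pos hε)
  refine ⟨N, fun n hn => ?_⟩
  have h1 := hN n hn
  have h2 : ‖x n - y n‖ ≤ ‖x - y‖ := lp.norm_apply_le_norm ENNReal.top_ne_zero (x - y) n
  have h3 := norm_sub_norm_le (x n) (y n)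
  rw [dist_eq_norm] at hxy
  simp only [dist_zero_right, norm_norm] at h1 ⊢
  linarith

instance instNormedAddCommGroupMatrixCorona : NormedAddCommGroup (MatrixCorona k) :=
  haveI := isClosed_matrixSum k
  Submodule.Quotient.normedAddCommGroup (matrixSum k)

instance instCompleteSpaceMatrixCorona : CompleteSpace (MatrixCorona k) :=
  Submodule.Quotient.completeSpace (matrixSum k)

theorem norm_coronaMk_le (x : MatrixProd k) : ‖coronaMk k x‖ ≤ ‖x‖ :=
  Submodule.Quotient.norm_mk_le (S := matrixSum k) x

/-- With `norm_coronaMk_le_of_eventually`, this identifies the quotient norm with the limsup of the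
coordinate norms, so that norm inequalities in the corona can be checked coordinatewise. -/
theorem eventually_norm_lt_of_norm_coronaMk_lt {x : MatrixProd k} {r : ℝ}
    (h : ‖coronaMk k x‖ < r) : ∀ᶠ n in atTop, ‖x n‖ < r := by
  obtain ⟨ε, hε, hr⟩ : ∃ ε > 0, ‖coronaMk k x‖ + ε + ε < r :=
    ⟨(r - ‖coronaMk k x‖) / 3, by linarith, by linarith⟩
  obtain ⟨y, hy, hyn⟩ := Submodule.Quotient.norm_mk_lt (S := matrixSum k) (coronaMk k x) hε
  have hxy : coronaMk k x = coronaMk k y := hy.symm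
  change ‖y‖ < ‖coronaMk k x‖ + ε at hyn
  rw [coronaMk_eq_iff] at hxy
  filter_upwards [hxy.eventually (gt_mem_nhds hε)] with n hn
  have h2 : ‖y n‖ ≤ ‖y‖ := lp.norm_apply_le_norm ENNReal.top_ne_zero y n
  have h3 := norm_sub_norm_le (x n) (y n)
  linarith

theorem norm_coronaMk_le_of_eventually {x : MatrixProd k} {r : ℝ} (hr : 0 ≤ r)
    (h : ∀ᶠ n in atTop, ‖x n‖ ≤ r) : ‖coronaMk k x‖ ≤ r := by
  obtain ⟨N, hN⟩ := eventually_atTop.1 h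
  -- Replacing the first `N` terms by 0 does not change the class.
  have hmem : Memℓp (fun n => if N ≤ n then x n else 0) ∞ := by
    refine memℓp_infty ⟨r, ?_⟩
    rintro _ ⟨n, rfl⟩
    dsimp only
    split_ifs with hn
    · exact hN n hn
    · simpa using hr
  let y : MatrixProd k := ⟨_, hmem⟩
  have hy : ∀ n, y n = if N ≤ n then x n else 0 := fun n => rfl
  have hxy : coronaMk k x = coronaMk k y := by
    rw [coronaMk_eq_iff]
    refine tendsto_const_nhds.congr' ?_
    filter_upwards [eventually_ge_atTop N] with n hn
    simp [hy, hn]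
  rw [hxy]
  refine (norm_coronaMk_le k y).trans (lp.norm_le_of_forall_le hr fun n => ?_)
  rw [hy]
  split_ifs with hn
  · exact hN n hn
  · simpa using hr

theorem norm_corona_mul_le (a b : MatrixCorona k) : ‖a * b‖ ≤ ‖a‖ * ‖b‖ := by
  obtain ⟨x, rfl⟩ := coronaMk_surjective k a
  obtain ⟨y, rfl⟩ := coronaMk_surjective k b
  have key : ∀ ε > (0 : ℝ), ‖coronaMk k x * coronaMk k y‖ ≤
      (‖coronaMk k x‖ + ε) * (‖coronaMk k y‖ + ε) := by
    intro ε hε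
    rw [← map_mul]
    refine norm_coronaMk_le_of_eventually k (by positivity) ?_
    filter_upwards [eventually_norm_lt_of_norm_coronaMk_lt k (lt_add_of_pos_right ‖coronaMk k x‖ hε),
      eventually_norm_lt_of_norm_coronaMk_lt k (lt_add_of_pos_right ‖coronaMk k y‖ hε)] with n h1 h2
    exact (norm_mul_le (x n) (y n)).trans (mul_le_mul h1.le h2.le (norm_nonneg _) (by positivity))
  have hlim : Tendsto (fun ε : ℝ => (‖coronaMk k x‖ + ε) * (‖coronaMk k y‖ + ε)) (𝓝[>] 0)
      (𝓝 (‖coronaMk k x‖ * ‖coronaMk k y‖)) := by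
    have : Continuous fun ε : ℝ => (‖coronaMk k x‖ + ε) * (‖coronaMk k y‖ + ε) := by fun_prop
    simpa using (this.tendsto 0).mono_left nhdsWithin_le_nhds
  exact ge_of_tendsto hlim (eventually_mem_nhdsWithin.mono key)

instance instNormedRingMatrixCorona : NormedRing (MatrixCorona k) where
  __ := instRingMatrixCorona k
  __ := instNormedAddCommGroupMatrixCorona k
  norm_mul_le := norm_corona_mul_le k

theorem norm_corona_smul_le (c : ℂ) (a : MatrixCorona k) : ‖c • a‖ ≤ ‖c‖ * ‖a‖ := by
  obtain ⟨x, rfl⟩ := coronaMk_surjective k a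
  have key : ∀ ε > (0 : ℝ), ‖c • coronaMk k x‖ ≤ ‖c‖ * (‖coronaMk k x‖ + ε) := by
    intro ε hε
    rw [← map_smul]
    refine norm_coronaMk_le_of_eventually k (by positivity) ?_
    filter_upwards [eventually_norm_lt_of_norm_coronaMk_lt k
      (lt_add_of_pos_right ‖coronaMk k x‖ hε)] with n h1
    exact (norm_smul_le c (x n)).trans (mul_le_mul_of_nonneg_left h1.le (norm_nonneg _))
  have hlim : Tendsto (fun ε : ℝ => ‖c‖ * (‖coronaMk k x‖ + ε)) (𝓝[>] 0)
      (𝓝 (‖c‖ * ‖coronaMk k x‖)) := by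
    have : Continuous fun ε : ℝ => ‖c‖ * (‖coronaMk k x‖ + ε) := by fun_prop
    simpa using (this.tendsto 0).mono_left nhdsWithin_le_nhds
  exact ge_of_tendsto hlim (eventually_mem_nhdsWithin.mono key)

instance instNormedAlgebraMatrixCorona : NormedAlgebra ℂ (MatrixCorona k) where
  __ := instAlgebraMatrixCorona k
  norm_smul_le := norm_corona_smul_le k

instance instCStarRingMatrixCorona : CStarRing (MatrixCorona k) where
  norm_mul_self_le a := by
    obtain ⟨x, rfl⟩ := coronaMk_surjective k a
    have key : ∀ r > ‖star (coronaMk k x) * coronaMk k x‖, ‖coronaMk k x‖ ≤ √r := by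
      intro r hr
      rw [star_coronaMk, ← map_mul] at hr
      refine norm_coronaMk_le_of_eventually k (Real.sqrt_nonneg _) ?_
      filter_upwards [eventually_norm_lt_of_norm_coronaMk_lt k hr] with n h1
      refine Real.le_sqrt_of_sq_le ?_
      rw [sq, ← CStarRing.norm_star_mul_self]
      exact h1.le
    have h2 : ‖coronaMk k x‖ ≤ √‖star (coronaMk k x) * coronaMk k x‖ := by
      have hlim : Tendsto (fun r : ℝ => √r) (𝓝[>] ‖star (coronaMk k x) * coronaMk k x‖)
          (𝓝 √‖star (coronaMk k x) * coronaMk k x‖) :=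
        (Real.continuous_sqrt.tendsto _).mono_left nhdsWithin_le_nhds
      exact ge_of_tendsto hlim (eventually_mem_nhdsWithin.mono key)
    rw [← sq]
    exact (Real.le_sqrt (norm_nonneg _) (norm_nonneg _)).1 h2

instance instStarModuleMatrixCorona : StarModule ℂ (MatrixCorona k) where
  star_smul c a := by
    obtain ⟨x, rfl⟩ := coronaMk_surjective k a
    rw [← map_smul, star_coronaMk, star_smul, map_smul, star_coronaMk]

instance instCStarAlgebraMatrixCorona : CStarAlgebra (MatrixCorona k) where
  __ := instNormedRingMatrixCorona k
  __ := instNormedAlgebraMatrixCorona k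
  __ := instStarRingMatrixCorona k
  __ := instCStarRingMatrixCorona k
  __ := instStarModuleMatrixCorona k
  __ := instCompleteSpaceMatrixCorona k

end CoronaNorm

/-! ### The universal property of the full group C*-algebra -/

section Universal

variable {G : Type u} [Group G] {B : Type*} [CStarAlgebra B]

/-- The extension of a unitary representation of `G` to the group algebra. -/
def groupAlgebraLift (U : G →* unitary B) : MonoidAlgebra ℂ G →ₐ[ℂ] B :=
  MonoidAlgebra.lift ℂ B G ((unitary B).subtype.comp U)

theorem groupAlgebraLift_single (U : G →* unitary B) (g : G) (c : ℂ) :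
    groupAlgebraLift U (MonoidAlgebra.single g c) = c • (U g : B) := by
  simp [groupAlgebraLift]

theorem groupAlgebraLift_star (U : G →* unitary B) (a : MonoidAlgebra ℂ G) :
    groupAlgebraLift U (star a) = star (groupAlgebraLift U a) := by
  induction a using MonoidAlgebra.induction_linear with
  | zero => simp
  | add a b ha hb => rw [star_add, map_add, ha, hb, map_add, star_add]
  | single g c =>
    rw [star_single, groupAlgebraLift_single, groupAlgebraLift_single, star_smul, map_inv,
      ← Unitary.star_eq_inv, Unitary.coe_star]
    rfl

/-- The pulled-back norm is a C*-seminorm, and the universal norm is the largest one. -/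
theorem norm_groupAlgebraLift_le (U : G →* unitary B) (a : MonoidAlgebra ℂ G) :
    ‖groupAlgebraLift U a‖ ≤ ‖a‖ := by
  let p : Seminorm ℂ (MonoidAlgebra ℂ G) :=
    (normSeminorm ℂ B).comp (groupAlgebraLift U).toLinearMap
  have hp : ∀ a, p a = ‖groupAlgebraLift U a‖ := fun a => rfl
  have : IsCStarSeminorm p :=
    { mul_le := fun a b => by rw [hp, map_mul]; exact norm_mul_le _ _
      star_mul_self := fun a => by
        rw [hp, map_mul, groupAlgebraLift_star, CStarRing.norm_star_mul_self]; rfl }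
  exact this.le_universalNorm a

theorem continuous_groupAlgebraLift (U : G →* unitary B) :
    Continuous (groupAlgebraLift U : MonoidAlgebra ℂ G →+* B) :=
  AddMonoidHomClass.continuous_of_bound (groupAlgebraLift U) 1 fun a => by
    simpa using norm_groupAlgebraLift_le U a

/-- The `*`-homomorphism on the full group C*-algebra given by a unitary representation. -/
def groupCStarLift (U : G →* unitary B) : GroupCStarAlgebra G →⋆ₙₐ[ℂ] B :=
  have hc := continuous_groupAlgebraLift U
  let f : GroupCStarAlgebra G →+* B :=
    Completion.extensionHom (groupAlgebraLift U : MonoidAlgebra ℂ G →+* B) hc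
  have hf : Continuous f := Completion.continuous_extension
  have hcoe : ∀ a : MonoidAlgebra ℂ G, f a = groupAlgebraLift U a :=
    fun a => Completion.extensionHom_coe _ hc a
  { toFun := f
    map_zero' := map_zero f
    map_add' := map_add f
    map_mul' := map_mul f
    map_smul' := fun c x => by
      induction x using Completion.induction_on with
      | hp => exact isClosed_eq (hf.comp (continuous_const_smul c)) (hf.const_smul _)
      | ih a => rw [← Completion.coe_smul, hcoe, hcoe, map_smul]; rfl
    map_star' := fun x => by
      have hs := continuous_star_groupCStarAlgebra (G := G)
      induction x using Completion.induction_on with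
      | hp => exact isClosed_eq (hf.comp hs) hf.star
      | ih a =>
        change f _ = star (f _)
        rw [star_coe, hcoe, hcoe, groupAlgebraLift_star] }

theorem groupCStarLift_coe (U : G →* unitary B) (a : MonoidAlgebra ℂ G) :
    groupCStarLift U (a : GroupCStarAlgebra G) = groupAlgebraLift U a :=
  Completion.extensionHom_coe _ (continuous_groupAlgebraLift U) a

end Universal

/-! ### A dimension obstruction to approximation by commuting matrices -/

section Obstruction

open Matrix Module

variable {ι : Type*} [Fintype ι]

/-- The square of the Euclidean norm of a vector. -/
def normSqVec (v : ι → ℂ) : ℝ := (star v ⬝ᵥ v).re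

theorem normSqVec_eq (v : ι → ℂ) : normSqVec v = ‖WithLp.toLp 2 v‖ ^ 2 := by
  rw [EuclideanSpace.norm_sq_eq, normSqVec, dotProduct, Complex.re_sum]
  refine Finset.sum_congr rfl fun i _ => ?_
  rw [Pi.star_apply, ← Complex.normSq_eq_norm_sq, mul_comm, Complex.star_def, Complex.mul_conj,
    Complex.ofReal_re]

theorem normSqVec_nonneg (v : ι → ℂ) : 0 ≤ normSqVec v := by
  rw [normSqVec_eq]; positivity

theorem normSqVec_eq_zero {v : ι → ℂ} : normSqVec v = 0 ↔ v = 0 := by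
  rw [normSqVec_eq]; simp

theorem normSqVec_prod {X ν : Type*} [Fintype X] [Fintype ν] (v : X × ν → ℂ) :
    normSqVec v = ∑ x, normSqVec fun a => v (x, a) := by
  simp only [normSqVec, dotProduct, Fintype.sum_prod_type, Complex.re_sum]
  rfl

theorem norm_dotProduct_mulVec_le [DecidableEq ι] (A : Matrix ι ι ℂ) (v w : ι → ℂ) :
    ‖star v ⬝ᵥ (A *ᵥ w)‖ ≤ ‖A‖ * (normSqVec v + normSqVec w) / 2 := by
  have h1 : star v ⬝ᵥ (A *ᵥ w) = inner ℂ (WithLp.toLp 2 v) (WithLp.toLp 2 (A *ᵥ w)) := by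
    rw [EuclideanSpace.inner_toLp_toLp, dotProduct_comm]
  have h2 := l2_opNorm_mulVec A (WithLp.toLp 2 w)
  have h3 := norm_inner_le_norm (𝕜 := ℂ) (WithLp.toLp 2 v) (WithLp.toLp 2 (A *ᵥ w))
  rw [h1, normSqVec_eq, normSqVec_eq]
  have h4 : ‖WithLp.toLp 2 (A *ᵥ w)‖ ≤ ‖A‖ * ‖WithLp.toLp 2 w‖ := h2
  have h5 := mul_le_mul_of_nonneg_left h4 (norm_nonneg (WithLp.toLp 2 v))
  -- The arithmetic-geometric mean inequality turns the Cauchy–Schwarz bound into one that is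
  -- additive over blocks.
  have h6 := mul_nonneg (norm_nonneg A)
    (sq_nonneg (‖WithLp.toLp 2 v‖ - ‖WithLp.toLp 2 w‖))
  nlinarith

/-- The quadratic form of the matrix `[[D, K], [Kᴴ, -D]]`. -/
def pairForm (D K : Matrix ι ι ℂ) (v w : ι → ℂ) : ℝ :=
  (star v ⬝ᵥ (D *ᵥ v)).re - (star w ⬝ᵥ (D *ᵥ w)).re + 2 * (star v ⬝ᵥ (K *ᵥ w)).re

theorem pairForm_sub (D K D' K' : Matrix ι ι ℂ) (v w : ι → ℂ) :
    pairForm (D - D') (K - K') v w = pairForm D K v w - pairForm D' K' v w := by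
  simp only [pairForm, sub_mulVec, dotProduct_sub, Complex.sub_re]
  ring

/-- Applied to differences, this shows that the form is stable under perturbation: changing `D` and
`K` by `η` in total moves it by at most `η` times the squared norm. -/
theorem abs_pairForm_le [DecidableEq ι] (D K : Matrix ι ι ℂ) (v w : ι → ℂ) :
    |pairForm D K v w| ≤ (‖D‖ + ‖K‖) * (normSqVec v + normSqVec w) := by
  have h1 := (Complex.abs_re_le_norm _).trans (norm_dotProduct_mulVec_le D v v)
  have h2 := (Complex.abs_re_le_norm _).trans (norm_dotProduct_mulVec_le D w w)
  have h3 := (Complex.abs_re_le_norm _).trans (norm_dotProduct_mulVec_le K v w)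
  rw [abs_le] at *
  rw [pairForm]
  constructor <;> linarith

theorem pairForm_comp_diagonal {X ν : Type*} [Fintype X] [DecidableEq X] [Fintype ν]
    (D K : X → Matrix ν ν ℂ) (v w : X × ν → ℂ) :
    pairForm (comp X X ν ν ℂ (diagonal D)) (comp X X ν ν ℂ (diagonal K)) v w =
      ∑ x, pairForm (D x) (K x) (fun a => v (x, a)) (fun a => w (x, a)) := by
  have key : ∀ (A : X → Matrix ν ν ℂ) (v w : X × ν → ℂ),
      star v ⬝ᵥ (comp X X ν ν ℂ (diagonal A) *ᵥ w) =
        ∑ x, star (fun a => v (x, a)) ⬝ᵥ (A x *ᵥ fun a => w (x, a)) := by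
    intro A v w
    simp only [dotProduct, mulVec, Fintype.sum_prod_type, comp_apply]
    refine Finset.sum_congr rfl fun x _ => Finset.sum_congr rfl fun a _ => ?_
    rw [Finset.sum_eq_single x]
    · simp
    · intro y _ hy
      simp [diagonal_apply_ne' _ hy]
    · simp
  simp only [pairForm, key, Complex.re_sum, Finset.mul_sum, ← Finset.sum_add_distrib,
    ← Finset.sum_sub_distrib]

/-- If `D` is self-adjoint and commutes with `K` then the quadratic form of
`[[D, K], [Kᴴ, -D]]` is nonpositive on a subspace of half the dimension. -/
theorem exists_pairForm_nonpos [DecidableEq ι] {D K : Matrix ι ι ℂ} (hD : IsSelfAdjoint D)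
    (hK : Commute D K) : ∃ S : Submodule ℂ ((ι → ℂ) × (ι → ℂ)),
      finrank ℂ S = Fintype.card ι ∧ ∀ p ∈ S, pairForm D K p.1 p.2 ≤ 0 := by
  -- `P` and `Q` are the square roots of the positive and negative parts of `D`.
  set P : Matrix ι ι ℂ := cfc (fun x : ℝ => √x) D with hP
  set Q : Matrix ι ι ℂ := cfc (fun x : ℝ => √(-x)) D with hQ
  have hPs : star P = P := (cfc_predicate (R := ℝ) (p := IsSelfAdjoint) _ D).star_eq
  have hQs : star Q = Q := (cfc_predicate (R := ℝ) (p := IsSelfAdjoint) _ D).star_eq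
  have hPQ : P * Q = 0 := by
    rw [hP, hQ, ← cfc_mul (fun x : ℝ => √x) (fun x : ℝ => √(-x)) D]
    rw [← cfc_zero ℝ D]
    refine cfc_congr fun x _ => ?_
    rcases le_total x 0 with h | h
    · simp [Real.sqrt_eq_zero_of_nonpos h]
    · simp [Real.sqrt_eq_zero_of_nonpos (neg_nonpos.2 h)]
  have hQP : Q * P = 0 := by
    have := congrArg star hPQ
    rwa [star_mul, hPs, hQs, star_zero] at this
  have hDPQ : D = P * P - Q * Q := by
    rw [hP, hQ, ← cfc_mul (fun x : ℝ => √x) (fun x : ℝ => √x) D,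
      ← cfc_mul (fun x : ℝ => √(-x)) (fun x : ℝ => √(-x)) D, ← cfc_sub _ _ D]
    conv_lhs => rw [← cfc_id' ℝ D]
    refine cfc_congr fun x _ => ?_
    rcases le_total x 0 with h | h
    · simp [Real.sqrt_eq_zero_of_nonpos h, Real.mul_self_sqrt (neg_nonneg.2 h)]
    · simp [Real.sqrt_eq_zero_of_nonpos (neg_nonpos.2 h), Real.mul_self_sqrt h]
  have hPK : P * K = K * P := (hK.cfc_real _).eq
  have hadj : ∀ (A : Matrix ι ι ℂ) (v w : ι → ℂ), star A = A →
      star v ⬝ᵥ (A *ᵥ w) = star (A *ᵥ v) ⬝ᵥ w := by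
    intro A v w hA
    rw [star_mulVec, ← star_eq_conjTranspose, hA, dotProduct_mulVec]
  -- On `ker P`, `D` acts as `-Q²`; on `range P` it acts as `P²` and enters with a minus sign. The
  -- cross term vanishes because `K` preserves `range P`, which is orthogonal to `ker P`.
  -- Rank-nullity gives the dimension.
  refine ⟨(LinearMap.ker P.mulVecLin).prod (LinearMap.range P.mulVecLin), ?_, ?_⟩
  · have := P.mulVecLin.finrank_range_add_finrank_ker
    rw [Module.finrank_fintype_fun_eq_card] at this
    let e : ((LinearMap.ker P.mulVecLin).prod (LinearMap.range P.mulVecLin)) ≃ₗ[ℂ]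
        LinearMap.ker P.mulVecLin × LinearMap.range P.mulVecLin :=
      { toFun := fun p => (⟨p.1.1, p.2.1⟩, ⟨p.1.2, p.2.2⟩)
        map_add' := fun _ _ => rfl
        map_smul' := fun _ _ => rfl
        invFun := fun p => ⟨(p.1.1, p.2.1), p.1.2, p.2.2⟩
        left_inv := fun _ => rfl
        right_inv := fun _ => rfl }
    rw [← this, e.finrank_eq, finrank_prod, add_comm]
  · rintro ⟨v, w⟩ ⟨hv, u, rfl⟩
    simp only [SetLike.mem_coe, LinearMap.mem_ker, mulVecLin_apply] at hv ⊢
    have e1 : star v ⬝ᵥ (D *ᵥ v) = -(star (Q *ᵥ v) ⬝ᵥ (Q *ᵥ v)) := by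
      rw [hDPQ, sub_mulVec, ← mulVec_mulVec, ← mulVec_mulVec, hv, mulVec_zero, zero_sub,
        dotProduct_neg, hadj Q _ _ hQs]
    have e2 : star (P *ᵥ u) ⬝ᵥ (D *ᵥ (P *ᵥ u)) =
        star (P *ᵥ (P *ᵥ u)) ⬝ᵥ (P *ᵥ (P *ᵥ u)) := by
      rw [hDPQ, sub_mulVec, ← hadj P _ _ hPs, ← mulVec_mulVec, ← mulVec_mulVec,
        mulVec_mulVec u Q P, hQP, zero_mulVec, mulVec_zero, sub_zero, hadj P _ _ hPs,
        hadj P _ _ hPs]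
    have e3 : star v ⬝ᵥ (K *ᵥ (P *ᵥ u)) = 0 := by
      rw [mulVec_mulVec, ← hPK, ← mulVec_mulVec, hadj P _ _ hPs, hv]
      simp
    have h1 := normSqVec_nonneg (Q *ᵥ v)
    have h2 := normSqVec_nonneg (P *ᵥ (P *ᵥ u))
    rw [normSqVec] at h1 h2
    rw [pairForm, e1, e2, e3]
    simp only [Complex.neg_re, Complex.zero_re, mul_zero]
    linarith

/-- Block diagonal matrices `D'`, `K'` such that the form of `[[D', K'], [K'ᴴ, -D']]` is positive
on a subspace of more than half the dimension are not close to commuting matrices. -/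
theorem not_close_of_finrank_lt {X ν : Type*} [Fintype X] [DecidableEq X] [Fintype ν]
    [DecidableEq ν] {D K : Matrix (X × ν) (X × ν) ℂ} (hD : IsSelfAdjoint D) (hK : Commute D K)
    (D' K' : X → Matrix ν ν ℂ) {δ : ℝ}
    (hclose : ‖D - comp X X ν ν ℂ (diagonal D')‖ + ‖K - comp X X ν ν ℂ (diagonal K')‖ < δ)
    (W : X → Submodule ℂ ((ν → ℂ) × (ν → ℂ)))
    (hW : ∀ x, ∀ p ∈ W x,
      δ * (normSqVec p.1 + normSqVec p.2) ≤ pairForm (D' x) (K' x) p.1 p.2)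
    (hcard : Fintype.card X * Fintype.card ν < ∑ x, finrank ℂ (W x)) : False := by
  obtain ⟨S, hS, hSneg⟩ := exists_pairForm_nonpos hD hK
  let r : X → ((X × ν → ℂ) × (X × ν → ℂ)) →ₗ[ℂ] ((ν → ℂ) × (ν → ℂ)) := fun x =>
    (LinearMap.funLeft ℂ ℂ fun a => (x, a)).prodMap (LinearMap.funLeft ℂ ℂ fun a => (x, a))
  -- The kernel of `Φ` is the intersection of `S` with the direct sum of the `W x`; it is nonzero
  -- since the two dimensions add up to more than the whole.
  let Φ : S →ₗ[ℂ] ∀ x, ((ν → ℂ) × (ν → ℂ)) ⧸ W x :=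
    LinearMap.pi fun x => (W x).mkQ.comp ((r x).comp S.subtype)
  have hdim : finrank ℂ (∀ x, ((ν → ℂ) × (ν → ℂ)) ⧸ W x) < finrank ℂ S := by
    rw [finrank_pi_fintype, hS, Fintype.card_prod]
    have h : ∀ x, finrank ℂ (((ν → ℂ) × (ν → ℂ)) ⧸ W x) + finrank ℂ (W x) =
        2 * Fintype.card ν := fun x => by
      rw [Submodule.finrank_quotient_add_finrank, finrank_prod, finrank_fintype_fun_eq_card]
      ring
    have h2 : ∑ x, finrank ℂ (((ν → ℂ) × (ν → ℂ)) ⧸ W x) + ∑ x, finrank ℂ (W x) =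
        Fintype.card X * (2 * Fintype.card ν) := by
      rw [← Finset.sum_add_distrib, Finset.sum_congr rfl fun x _ => h x]
      simp
    have h3 : Fintype.card X * (2 * Fintype.card ν) =
        Fintype.card X * Fintype.card ν + Fintype.card X * Fintype.card ν := by ring
    omega
  obtain ⟨p, hp, hp0⟩ := (Submodule.ne_bot_iff _).1 (Φ.ker_ne_bot_of_finrank_lt hdim)
  obtain ⟨⟨v, w⟩, hvw⟩ := p
  have hmem : ∀ x, ((fun a => v (x, a)), (fun a => w (x, a))) ∈ W x := fun x => by
    have := congrFun (LinearMap.mem_ker.1 hp) x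
    exact (Submodule.Quotient.mk_eq_zero _).1 this
  have hpos : δ * (normSqVec v + normSqVec w) ≤
      pairForm (comp X X ν ν ℂ (diagonal D')) (comp X X ν ν ℂ (diagonal K')) v w := by
    rw [pairForm_comp_diagonal, normSqVec_prod, normSqVec_prod, ← Finset.sum_add_distrib,
      Finset.mul_sum]
    exact Finset.sum_le_sum fun x _ => hW x _ (hmem x)
  have hneg := hSneg _ hvw
  have hdiff := abs_pairForm_le (D - comp X X ν ν ℂ (diagonal D'))
    (K - comp X X ν ν ℂ (diagonal K')) v w
  rw [pairForm_sub, abs_le] at hdiff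
  have hne : 0 < normSqVec v + normSqVec w := by
    refine lt_of_le_of_ne (add_nonneg (normSqVec_nonneg _) (normSqVec_nonneg _)) fun h => hp0 ?_
    have hv : normSqVec v = 0 := by linarith [normSqVec_nonneg v, normSqVec_nonneg w]
    have hw : normSqVec w = 0 := by linarith [normSqVec_nonneg v, normSqVec_nonneg w]
    exact Subtype.ext (Prod.ext (normSqVec_eq_zero.1 hv) (normSqVec_eq_zero.1 hw))
  have := mul_lt_mul_of_pos_right hclose hne
  simp only at hneg
  linarith [hdiff.1]

end Obstruction

/-! ### Spin matrices -/

section Spin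

open Matrix Module

/-- The coefficients of the raising operator of the irreducible representation of `𝔰𝔩₂` of
dimension `n + 2`. -/
def spinCoeff (n : ℕ) (a : Fin (n + 1)) : ℝ := √((a + 1) * (n + 1 - a))

/-- Half of the highest weight of the representation of dimension `n + 2`. -/
def spin (n : ℕ) : ℝ := (n + 1) / 2

/-- The weight operator of the spin representation, divided by the spin. -/
def spinZ (n : ℕ) : Matrix (Fin (n + 2)) (Fin (n + 2)) ℂ :=
  diagonal fun a => (((a - spin n) / spin n : ℝ) : ℂ)

/-- The raising operator of the spin representation, divided by the spin. -/
def spinM (n : ℕ) : Matrix (Fin (n + 2)) (Fin (n + 2)) ℂ :=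
  Matrix.of fun a b => Fin.cases 0 (fun c => if b = c.castSucc then
    ((spinCoeff n c / spin n : ℝ) : ℂ) else 0) a

theorem spinM_zero (n : ℕ) (b : Fin (n + 2)) : spinM n 0 b = 0 := rfl

theorem spinM_succ (n : ℕ) (a : Fin (n + 1)) (b : Fin (n + 2)) :
    spinM n a.succ b = if b = a.castSucc then ((spinCoeff n a / spin n : ℝ) : ℂ) else 0 := rfl

theorem spin_pos (n : ℕ) : 0 < spin n := by
  unfold spin; positivity

theorem spinCoeff_sq (n : ℕ) (a : Fin (n + 1)) :
    spinCoeff n a * spinCoeff n a = (a + 1) * (n + 1 - a) := by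
  have : (a : ℝ) < n + 1 := by exact_mod_cast a.2
  exact Real.mul_self_sqrt (mul_nonneg (by positivity) (by linarith))

theorem star_spinZ (n : ℕ) : star (spinZ n) = spinZ n := by
  rw [spinZ, star_eq_conjTranspose, diagonal_conjTranspose]
  congr 1
  ext a
  simp

theorem norm_spinZ_le (n : ℕ) : ‖spinZ n‖ ≤ 1 := by
  rw [spinZ, l2_opNorm_diagonal, pi_norm_le_iff_of_nonneg zero_le_one]
  intro a
  have h1 := spin_pos n
  have h2 : (a : ℝ) ≤ n + 1 := by exact_mod_cast Nat.lt_succ_iff.1 a.2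
  have h3 : (0 : ℝ) ≤ a := Nat.cast_nonneg _
  rw [Complex.norm_real, Real.norm_eq_abs, abs_div, abs_of_pos h1, div_le_one h1, abs_le]
  unfold spin
  constructor <;> linarith

theorem spinM_mul_star (n : ℕ) : spinM n * star (spinM n) =
    diagonal fun a : Fin (n + 2) => ((a * (n + 2 - a) / spin n ^ 2 : ℝ) : ℂ) := by
  ext a b
  rw [mul_apply]
  simp only [star_apply]
  refine Fin.cases ?_ (fun a => ?_) a
  · simp only [spinM_zero, zero_mul, Finset.sum_const_zero]
    by_cases h : (0 : Fin (n + 2)) = b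
    · subst h; simp
    · rw [diagonal_apply_ne _ h]
  · refine Fin.cases ?_ (fun b => ?_) b
    · simp [spinM_zero]
    · simp only [spinM_succ, ite_mul, zero_mul, Finset.sum_ite_eq', Finset.mem_univ, if_true]
      by_cases h : a = b
      · subst h
        have := spinCoeff_sq n a
        rw [if_pos rfl, diagonal_apply_eq, Complex.star_def, Complex.conj_ofReal,
          ← Complex.ofReal_mul, div_mul_div_comm, this, Fin.val_succ]
        push_cast
        ring
      · rw [diagonal_apply_ne _ (fun h' => h (Fin.succ_injective _ h')),
          if_neg (fun h' => h (Fin.castSucc_injective _ h'))]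
        simp

theorem star_mul_spinM (n : ℕ) : star (spinM n) * spinM n =
    diagonal fun a : Fin (n + 2) => (((a + 1) * (n + 1 - a) / spin n ^ 2 : ℝ) : ℂ) := by
  ext a b
  rw [mul_apply, Fin.sum_univ_succ]
  simp only [star_apply, spinM_zero, spinM_succ, mul_zero, zero_add, mul_ite]
  refine Fin.lastCases ?_ (fun b => ?_) b
  · rw [Finset.sum_eq_zero fun c _ => if_neg (Fin.castSucc_lt_last c).ne']
    by_cases h : a = Fin.last (n + 1)
    · subst h; simp
    · rw [diagonal_apply_ne _ h]
  · simp only [Fin.castSucc_inj, Finset.sum_ite_eq, Finset.mem_univ, if_true]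
    by_cases h : a = b.castSucc
    · subst h
      have := spinCoeff_sq n b
      rw [if_pos rfl, diagonal_apply_eq, Complex.star_def, Complex.conj_ofReal,
          ← Complex.ofReal_mul, div_mul_div_comm, this, Fin.val_castSucc]
      push_cast
      ring
    · rw [diagonal_apply_ne _ h, if_neg h]
      simp

theorem norm_spinM_le (n : ℕ) : ‖spinM n‖ ≤ 2 := by
  have h : ‖spinM n * star (spinM n)‖ ≤ 4 := by
    rw [spinM_mul_star, l2_opNorm_diagonal, pi_norm_le_iff_of_nonneg (by norm_num)]
    intro a
    have h1 := spin_pos n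
    have h2 : (a : ℝ) ≤ n + 1 := by exact_mod_cast Nat.lt_succ_iff.1 a.2
    have h3 : (0 : ℝ) ≤ a := Nat.cast_nonneg _
    rw [Complex.norm_real, Real.norm_eq_abs, abs_div, abs_of_pos (by positivity : 0 < spin n ^ 2),
      div_le_iff₀ (by positivity), abs_of_nonneg (mul_nonneg h3 (by linarith))]
    unfold spin
    have h4 : (0 : ℝ) ≤ n := n.cast_nonneg
    -- `a (n + 2 - a) ≤ ((n + 2) / 2)² ≤ (n + 1)² = 4 (spin n)²`, with equality possible at `n = 0`.
    nlinarith [sq_nonneg ((a : ℝ) - (n + 2) / 2)]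
  rw [CStarRing.norm_self_mul_star] at h
  nlinarith [norm_nonneg (spinM n)]

/-- These are the relations `[J_z, J_+] = J_+` and `[J_+, J_-] = 2 J_z`: dividing each factor by the
spin leaves one inverse power of it in the commutator. -/
theorem spinZ_mul_spinM_sub (n : ℕ) :
    spinZ n * spinM n - spinM n * spinZ n = (((spin n)⁻¹ : ℝ) : ℂ) • spinM n := by
  ext a b
  rw [Matrix.sub_apply, Matrix.smul_apply, spinZ, diagonal_mul, mul_diagonal]
  refine Fin.cases ?_ (fun a => ?_) a
  · simp [spinM_zero]
  · rw [spinM_succ]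
    split_ifs with h
    · subst h
      have := (spin_pos n).ne'
      rw [smul_eq_mul, ← sub_eq_zero]
      push_cast [Fin.val_succ, Fin.val_castSucc]
      field_simp
      ring
    · simp

theorem spinM_mul_star_sub (n : ℕ) : spinM n * star (spinM n) - star (spinM n) * spinM n =
    ((2 * (spin n)⁻¹ : ℝ) : ℂ) • spinZ n := by
  rw [spinM_mul_star, star_mul_spinM, diagonal_sub, spinZ, ← diagonal_smul]
  congr 1
  ext a
  have h := (spin_pos n).ne'
  have h' : (n : ℝ) = 2 * spin n - 1 := by unfold spin; ring
  have h2 : (spin n : ℂ) ≠ 0 := by exact_mod_cast h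
  rw [h', Pi.smul_apply, smul_eq_mul]
  push_cast
  field_simp
  ring

theorem norm_spinZ_mul_spinM_sub_le (n : ℕ) :
    ‖spinZ n * spinM n - spinM n * spinZ n‖ ≤ 2 * (spin n)⁻¹ := by
  rw [spinZ_mul_spinM_sub, norm_smul, Complex.norm_real, Real.norm_eq_abs,
    abs_of_pos (inv_pos.2 (spin_pos n)), mul_comm]
  exact mul_le_mul_of_nonneg_right (norm_spinM_le n) (inv_nonneg.2 (spin_pos n).le)

theorem norm_spinM_mul_star_sub_le (n : ℕ) :
    ‖spinM n * star (spinM n) - star (spinM n) * spinM n‖ ≤ 2 * (spin n)⁻¹ := by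
  rw [spinM_mul_star_sub, norm_smul, Complex.norm_real, Real.norm_eq_abs, abs_mul,
    abs_of_pos (inv_pos.2 (spin_pos n)), abs_of_pos two_pos]
  have := mul_le_mul_of_nonneg_left (norm_spinZ_le n) (inv_nonneg.2 (spin_pos n).le)
  linarith

theorem tendsto_spin_inv : Tendsto (fun n => 2 * (spin n)⁻¹) atTop (𝓝 0) := by
  have h : Tendsto spin atTop atTop := by
    have : Tendsto (fun n : ℕ => (n : ℝ)) atTop atTop := tendsto_natCast_atTop_atTop
    exact (this.atTop_add tendsto_const_nhds).atTop_div_const two_pos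
  simpa using h.inv_tendsto_atTop.const_mul 2

theorem spinM_mulVec_succ (n : ℕ) (v : Fin (n + 2) → ℂ) (a : Fin (n + 1)) :
    (spinM n *ᵥ v) a.succ = ((spinCoeff n a / spin n : ℝ) : ℂ) * v a.castSucc := by
  simp [mulVec, dotProduct, spinM_succ]

theorem spinM_mulVec_zero (n : ℕ) (v : Fin (n + 2) → ℂ) : (spinM n *ᵥ v) 0 = 0 := by
  simp [mulVec, dotProduct, spinM_zero]

/-- The highest weight subspace of the tensor product of the spin representation with `ℂ²`. -/
def spinSubspace (n : ℕ) : Submodule ℂ ((Fin (n + 2) → ℂ) × (Fin (n + 2) → ℂ)) :=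
  LinearMap.ker (LinearMap.pi fun a : Fin (n + 1) =>
    ((a + 1 : ℂ) • (LinearMap.proj a.succ ∘ₗ LinearMap.snd ℂ _ _) -
      (spinCoeff n a : ℂ) • (LinearMap.proj a.castSucc ∘ₗ LinearMap.fst ℂ _ _) :
      (Fin (n + 2) → ℂ) × (Fin (n + 2) → ℂ) →ₗ[ℂ] ℂ))

theorem mem_spinSubspace {n : ℕ} {p : (Fin (n + 2) → ℂ) × (Fin (n + 2) → ℂ)} :
    p ∈ spinSubspace n ↔ ∀ a : Fin (n + 1),
      (a + 1 : ℂ) * p.2 a.succ = spinCoeff n a * p.1 a.castSucc := by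
  simp [spinSubspace, LinearMap.mem_ker, funext_iff, sub_eq_zero]

/-- There are `n + 1` equations in `2 (n + 2)` unknowns. The one dimension gained over half is the
whole obstruction. -/
theorem lt_finrank_spinSubspace (n : ℕ) : n + 2 < finrank ℂ (spinSubspace n) := by
  have h := LinearMap.finrank_range_add_finrank_ker
    (LinearMap.pi fun a : Fin (n + 1) =>
    ((a + 1 : ℂ) • (LinearMap.proj a.succ ∘ₗ LinearMap.snd ℂ _ _) -
      (spinCoeff n a : ℂ) • (LinearMap.proj a.castSucc ∘ₗ LinearMap.fst ℂ _ _) :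
      (Fin (n + 2) → ℂ) × (Fin (n + 2) → ℂ) →ₗ[ℂ] ℂ))
  have h2 := Submodule.finrank_le (LinearMap.range (LinearMap.pi fun a : Fin (n + 1) =>
    ((a + 1 : ℂ) • (LinearMap.proj a.succ ∘ₗ LinearMap.snd ℂ _ _) -
      (spinCoeff n a : ℂ) • (LinearMap.proj a.castSucc ∘ₗ LinearMap.fst ℂ _ _) :
      (Fin (n + 2) → ℂ) × (Fin (n + 2) → ℂ) →ₗ[ℂ] ℂ)))
  rw [finrank_fintype_fun_eq_card, Fintype.card_fin] at h2
  rw [finrank_prod, finrank_fintype_fun_eq_card, Fintype.card_fin] at h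
  unfold spinSubspace
  omega

/-- The defining equations of the subspace say that `(v, w)` is fixed by `[[Z, M*], [M, -Z]]`: this
is the eigenvalue of `σ·J / j` on the component of spin `j + 1/2`. -/
theorem pairForm_spin {n : ℕ} {p : (Fin (n + 2) → ℂ) × (Fin (n + 2) → ℂ)}
    (hp : p ∈ spinSubspace n) :
    pairForm (spinZ n) (star (spinM n)) p.1 p.2 = normSqVec p.1 + normSqVec p.2 := by
  obtain ⟨v, w⟩ := p
  rw [mem_spinSubspace] at hp
  simp only at hp ⊢
  have hs : (spin n : ℂ) ≠ 0 := by exact_mod_cast (spin_pos n).ne'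
  have hn : (n : ℂ) = 2 * spin n - 1 := by
    have : (n : ℝ) = 2 * spin n - 1 := by unfold spin; ring
    exact_mod_cast this
  have hsq : ∀ a : Fin (n + 1), (spinCoeff n a : ℂ) * spinCoeff n a = (a + 1) * (n + 1 - a) := by
    intro a
    exact_mod_cast spinCoeff_sq n a
  have h1 : spinM n *ᵥ v = spinZ n *ᵥ w + w := by
    ext a
    rw [Pi.add_apply, spinZ, mulVec_diagonal]
    refine Fin.cases ?_ (fun a => ?_) a
    · rw [spinM_mulVec_zero]
      simp [hs, neg_div]
    · rw [spinM_mulVec_succ]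
      have := hp a
      push_cast [Fin.val_succ]
      field_simp
      rw [← this]
      ring
  have h2 : star (spinM n) *ᵥ w = v - spinZ n *ᵥ v := by
    ext a
    rw [Pi.sub_apply, spinZ, mulVec_diagonal, mulVec, dotProduct, Fin.sum_univ_succ]
    simp only [star_apply, spinM_zero, spinM_succ, star_zero, zero_mul, zero_add]
    refine Fin.lastCases ?_ (fun a => ?_) a
    · rw [Finset.sum_eq_zero fun c _ => by simp [(Fin.castSucc_lt_last c).ne']]
      push_cast [Fin.val_last]
      rw [hn]
      field_simp
      ring
    · simp only [Fin.castSucc_inj]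
      rw [Finset.sum_eq_single a (fun b _ hb => by simp [hb.symm]) (by simp), if_pos rfl,
        Complex.star_def, Complex.conj_ofReal]
      have h3 := hp a
      have h4 := hsq a
      have h5 : (a + 1 : ℂ) ≠ 0 := by exact_mod_cast Nat.succ_ne_zero (a : ℕ)
      -- Multiplying the defining equation by `spinCoeff n a` lets the factor `a + 1` cancel.
      have h6 : (spinCoeff n a : ℂ) * w a.succ = (n + 1 - a) * v a.castSucc := by
        apply mul_left_cancel₀ h5
        linear_combination (spinCoeff n a : ℂ) * h3 + v a.castSucc * h4
      push_cast [Fin.val_castSucc]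
      field_simp
      rw [h6, hn]
      ring
  have h3 : star v ⬝ᵥ (star (spinM n) *ᵥ w) = star (spinM n *ᵥ v) ⬝ᵥ w := by
    rw [star_mulVec, ← star_eq_conjTranspose, dotProduct_mulVec]
  have h4 : star (spinZ n *ᵥ w) ⬝ᵥ w = star w ⬝ᵥ (spinZ n *ᵥ w) := by
    rw [star_mulVec, ← star_eq_conjTranspose, star_spinZ, dotProduct_mulVec]
  have h5 : (star v ⬝ᵥ (star (spinM n) *ᵥ w)).re =
      (star w ⬝ᵥ (spinZ n *ᵥ w)).re + normSqVec w := by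
    rw [h3, h1, star_add, add_dotProduct, h4, Complex.add_re, normSqVec]
  have h6 : (star v ⬝ᵥ (star (spinM n) *ᵥ w)).re =
      normSqVec v - (star v ⬝ᵥ (spinZ n *ᵥ v)).re := by
    rw [h2, dotProduct_sub, Complex.sub_re, normSqVec]
  rw [pairForm]
  linarith

end Spin

/-! ### Cayley transforms -/

section Cayley

variable {B : Type*} [CStarAlgebra B]

theorem norm_one_le_of_cstar : ‖(1 : B)‖ ≤ 1 := by
  have h := CStarRing.norm_star_mul_self (x := (1 : B))
  rw [star_one, one_mul] at h
  nlinarith [norm_nonneg (1 : B)]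

theorem norm_le_one_of_unitary (U : unitary B) : ‖(U : B)‖ ≤ 1 := by
  have h := CStarRing.norm_star_mul_self (x := (U : B))
  rw [Unitary.coe_star_mul_self] at h
  nlinarith [norm_nonneg (U : B), norm_one_le_of_cstar (B := B)]

theorem norm_pow_sub_one_le (V : unitary B) (k : ℕ) :
    ‖(V : B) ^ k - 1‖ ≤ k * ‖(V : B) - 1‖ := by
  induction k with
  | zero => simp
  | succ k ih =>
    have h : (V : B) ^ (k + 1) - 1 = ((V : B) ^ k - 1) * V + (V - 1) := by
      rw [pow_succ]; noncomm_ring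
    rw [h]
    have h2 := norm_mul_le ((V : B) ^ k - 1) V
    have h3 := mul_le_mul_of_nonneg_left (norm_le_one_of_unitary V) (norm_nonneg ((V : B) ^ k - 1))
    have h4 := norm_add_le (((V : B) ^ k - 1) * V) (V - 1)
    push_cast
    linarith

theorem norm_zpow_sub_one_le (V : unitary B) (z : ℤ) :
    ‖((V ^ z : unitary B) : B) - 1‖ ≤ |z| * ‖(V : B) - 1‖ := by
  obtain ⟨k, rfl | rfl⟩ := z.eq_nat_or_neg
  · simpa using norm_pow_sub_one_le V k
  · have h : ((V ^ (-(k : ℤ)) : unitary B) : B) - 1 = star ((V : B) ^ k - 1) := by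
      rw [zpow_neg, ← Unitary.star_eq_inv]
      simp
    rw [h, norm_star]
    simpa using norm_pow_sub_one_le V k

/-- The error is quadratic in `V - 1`, so for a fixed exponent the linear term dominates once `V` is
close enough to 1. -/
theorem norm_pow_sub_one_sub_le (V : unitary B) (k : ℕ) :
    ‖(V : B) ^ k - 1 - (k : ℂ) • ((V : B) - 1)‖ ≤ k ^ 2 * ‖(V : B) - 1‖ ^ 2 := by
  induction k with
  | zero => simp
  | succ k ih =>
    have h : (V : B) ^ (k + 1) - 1 - ((k + 1 : ℕ) : ℂ) • ((V : B) - 1) =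
        ((V : B) ^ k - 1 - (k : ℂ) • ((V : B) - 1)) + ((V : B) ^ k - 1) * (V - 1) := by
      rw [pow_succ]
      push_cast
      rw [add_smul, one_smul]
      noncomm_ring
    rw [h]
    have h2 := norm_mul_le ((V : B) ^ k - 1) (V - 1)
    have h3 := mul_le_mul_of_nonneg_right (norm_pow_sub_one_le V k) (norm_nonneg ((V : B) - 1))
    have h4 := norm_add_le ((V : B) ^ k - 1 - (k : ℂ) • ((V : B) - 1)) (((V : B) ^ k - 1) * (V - 1))
    have h5 : 0 ≤ ((k : ℝ) + 1) * ‖(V : B) - 1‖ ^ 2 := by positivity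
    push_cast
    nlinarith

/-- Cayley transforms: every self-adjoint element is the derivative of a path of unitaries, each of
which commutes with whatever commutes with the element. -/
theorem exists_unitary_near_exp {A : B} (hA : IsSelfAdjoint A) (hA2 : ‖A‖ ≤ 2) {ε : ℝ}
    (hε : 0 < ε) (hε8 : ε ≤ 1 / 8) : ∃ V : unitary B, ‖(V : B) - 1‖ ≤ 8 * ε ∧
      (∀ k : ℕ, 1 ≤ k → ‖(V : B) ^ k - 1 - (2 * k * ε * Complex.I : ℂ) • A‖ ≤ 80 * k ^ 2 * ε ^ 2) ∧
      ∀ {C : Type} [Ring C] [Algebra ℂ C] (f : B →ₐ[ℂ] C) (x : C), Commute x (f A) →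
        Commute x (f V) := by
  -- `V` is `(1 + a)(1 - a)⁻¹` with `a = iεA` skew-adjoint. As a rational expression in `A`, it
  -- inherits commutation under any algebra homomorphism; this is needed because the spin operators
  -- commute only in the corona.
  set a : B := (ε * Complex.I : ℂ) • A with ha
  have hsa : star a = -a := by
    rw [ha, star_smul, hA.star_eq, ← neg_smul]
    simp
  have hna : ‖a‖ ≤ 2 * ε := by
    rw [ha, norm_smul, norm_mul, Complex.norm_I, Complex.norm_real, Real.norm_of_nonneg hε.le]
    nlinarith
  have hna1 : ‖a‖ < 1 := by linarith
  set W : Bˣ := Units.oneSub a hna1 with hW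
  have hWv : (W : B) = 1 - a := rfl
  set R : B := ((W⁻¹ : Bˣ) : B) with hR
  have hR1 : R * (1 - a) = 1 := by rw [hR, ← hWv, Units.inv_mul]
  have hR2 : (1 - a) * R = 1 := by rw [hR, ← hWv, Units.mul_inv]
  have hsR1 : (1 + a) * star R = 1 := by
    have := congrArg star hR1
    rwa [star_mul, star_sub, hsa, star_one, sub_neg_eq_add] at this
  have hsR2 : star R * (1 + a) = 1 := by
    have := congrArg star hR2
    rwa [star_mul, star_sub, hsa, star_one, sub_neg_eq_add] at this
  have hcomm : (1 + a) * R = R * (1 + a) := by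
    have h1 : (1 + a) * (1 - a) = (1 - a) * (1 + a) := by noncomm_ring
    calc (1 + a) * R = R * (1 - a) * ((1 + a) * R) := by rw [hR1, one_mul]
      _ = R * ((1 - a) * (1 + a)) * R := by noncomm_ring
      _ = R * (1 + a) * ((1 - a) * R) := by rw [← h1]; noncomm_ring
      _ = R * (1 + a) := by rw [hR2, mul_one]
  have hnR : ‖R‖ ≤ 2 := by
    have h1 : R = 1 + R * a := by
      have : R - R * a = 1 := by rw [← hR1]; noncomm_ring
      rw [← this]; abel
    have h2 := norm_add_le 1 (R * a)
    rw [← h1] at h2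
    have h3 := norm_mul_le R a
    have h4 := norm_one_le_of_cstar (B := B)
    have h5 := mul_le_mul_of_nonneg_left (hna.trans (by linarith : 2 * ε ≤ 1 / 2)) (norm_nonneg R)
    linarith
  have hstarV : star ((1 + a) * R) = star R * (1 - a) := by
    rw [star_mul, star_add, hsa, star_one, ← sub_eq_add_neg]
  have hV : (1 + a) * R ∈ unitary B := by
    rw [Unitary.mem_iff, hstarV]
    constructor
    · calc star R * (1 - a) * ((1 + a) * R) = star R * ((1 + a) * ((1 - a) * R)) := by
            noncomm_ring
        _ = 1 := by rw [hR2, mul_one, hsR2]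
    · calc (1 + a) * R * (star R * (1 - a)) = R * ((1 + a) * star R) * (1 - a) := by
            rw [hcomm]; noncomm_ring
        _ = 1 := by rw [hsR1, mul_one, hR1]
  have hV1 : (1 + a) * R - 1 = (2 : ℂ) • (a * R) := by
    rw [two_smul]; nth_rw 2 [← hR2]; noncomm_ring
  have hV2 : (1 + a) * R - 1 - (2 : ℂ) • a = (2 : ℂ) • (a * (a * R)) := by
    have : a = a * (1 - a) * R := by rw [mul_assoc, hR2, mul_one]
    rw [hV1]; nth_rw 2 [this]; rw [← smul_sub]; congr 1; noncomm_ring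
  have hnaR : ‖a * R‖ ≤ 4 * ε := by
    refine (norm_mul_le _ _).trans ?_
    nlinarith [norm_nonneg a, norm_nonneg R]
  have hn1 : ‖(1 + a) * R - 1‖ ≤ 8 * ε := by
    rw [hV1, norm_smul, Complex.norm_ofNat]; linarith
  have hn2 : ‖(1 + a) * R - 1 - (2 : ℂ) • a‖ ≤ 16 * ε ^ 2 := by
    rw [hV2, norm_smul, Complex.norm_ofNat]
    have := norm_mul_le a (a * R)
    nlinarith [norm_nonneg a, norm_nonneg (a * R)]
  -- The constant 80 is `64 + 16`: `64 k² ε²` from linearizing the power, and `16 k ε²` from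
  -- linearizing `V`.
  refine ⟨⟨_, hV⟩, hn1, fun k hk => ?_, fun {C} _ _ f x hx => ?_⟩
  · have h1 := norm_pow_sub_one_sub_le ⟨_, hV⟩ k
    simp only at h1 ⊢
    have h2 : (k : ℂ) • ((1 + a) * R - 1) - (2 * k * ε * Complex.I : ℂ) • A =
        (k : ℂ) • ((1 + a) * R - 1 - (2 : ℂ) • a) := by
      rw [smul_sub _ ((1 + a) * R - 1), ha, smul_smul, smul_smul]
      congr 2; ring
    have h3 : ‖(k : ℂ) • ((1 + a) * R - 1) - (2 * k * ε * Complex.I : ℂ) • A‖ ≤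
        k * (16 * ε ^ 2) := by
      rw [h2, norm_smul, Complex.norm_natCast]
      exact mul_le_mul_of_nonneg_left hn2 k.cast_nonneg
    have h4 := norm_add_le (((1 + a) * R) ^ k - 1 - (k : ℂ) • ((1 + a) * R - 1))
      ((k : ℂ) • ((1 + a) * R - 1) - (2 * k * ε * Complex.I : ℂ) • A)
    rw [sub_add_sub_cancel] at h4
    have hk1 : (1 : ℝ) ≤ k := by exact_mod_cast hk
    have h5 : ‖(1 + a) * R - 1‖ ^ 2 ≤ (8 * ε) ^ 2 := pow_le_pow_left₀ (norm_nonneg _) hn1 2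
    have h6 : (k : ℝ) ^ 2 * ‖(1 + a) * R - 1‖ ^ 2 ≤ k ^ 2 * (8 * ε) ^ 2 :=
      mul_le_mul_of_nonneg_left h5 (by positivity)
    have h7 : (k : ℝ) * (16 * ε ^ 2) ≤ k ^ 2 * (16 * ε ^ 2) :=
      mul_le_mul_of_nonneg_right (by nlinarith) (by positivity)
    linarith
  · have hxa : Commute x (f a) := by rw [ha, map_smul]; exact hx.smul_right _
    have hxR : Commute x (f R) := by
      have h1 : Commute x ((Units.map (f : B →* C) W : Cˣ) : C) := by
        change Commute x (f (1 - a))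
        rw [map_sub, map_one]
        exact (Commute.one_right x).sub_right hxa
      exact h1.units_inv_right
    change Commute x (f ((1 + a) * R))
    rw [map_mul, map_add, map_one]
    exact ((Commute.one_right x).add_right hxa).mul_right hxR

end Cayley

/-! ### Test elements -/

section TestElements

variable {κ : Type*}

/-! ### Test elements in a `*`-algebra: naturality, self-adjointness, commutation -/

section Algebraic

variable {B C : Type*} [Ring B] [StarRing B] [Algebra ℂ B] [Ring C] [StarRing C] [Algebra ℂ C]

/-- The imaginary part of an element of a `*`-algebra. -/
def imElt (b : B) : B := (-(Complex.I / 2) : ℂ) • (b - star b)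

/-- The deviation of a family of elements from the identity, as a self-adjoint element. -/
def devElt [Fintype κ] (u : κ → B) : B := ∑ l, (1 - (1 / 2 : ℂ) • (u l + star (u l)))

/-- The imaginary part of one of the elements of a family, plus a multiple of the deviation of the
family from the identity. -/
def diagElt [Fintype κ] (c : ℝ) (i : κ) (u : κ → B) : B := imElt (u i) + (c : ℂ) • devElt u

/-- `Im uᵢ - √-1 Im uⱼ`. -/
def offElt (i j : κ) (u : κ → B) : B := imElt (u i) - Complex.I • imElt (u j)

/-- Naturality allows the test elements to be formed in `ℂ[G]`, where they commute exactly, and to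
be evaluated in the blocks. -/
theorem map_imElt (f : B →ₐ[ℂ] C) (hf : ∀ b, f (star b) = star (f b)) (b : B) :
    f (imElt b) = imElt (f b) := by
  rw [imElt, imElt, map_smul, map_sub, hf]

theorem map_diagElt [Fintype κ] (f : B →ₐ[ℂ] C) (hf : ∀ b, f (star b) = star (f b)) (c : ℝ) (i : κ)
    (u : κ → B) : f (diagElt c i u) = diagElt c i fun l => f (u l) := by
  simp only [diagElt, devElt, map_add, map_smul, map_imElt f hf, map_sum, map_sub, map_one, hf]

theorem map_offElt (f : B →ₐ[ℂ] C) (hf : ∀ b, f (star b) = star (f b)) (i j : κ)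
    (u : κ → B) : f (offElt i j u) = offElt i j fun l => f (u l) := by
  simp only [offElt, map_sub, map_smul, map_imElt f hf]

theorem isSelfAdjoint_diagElt [Fintype κ] [StarModule ℂ B] (c : ℝ) (i : κ) (u : κ → B) :
    IsSelfAdjoint (diagElt c i u) := by
  have h1 : star (1 / 2 : ℂ) = 1 / 2 := by simp
  have h2 : star (-(Complex.I / 2)) = Complex.I / 2 := by simp [neg_div]
  have h3 : star (c : ℂ) = c := Complex.conj_ofReal c
  rw [IsSelfAdjoint]
  simp only [diagElt, devElt, imElt, star_add, star_smul, star_sub, star_star, star_sum, star_one,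
    h1, h2, h3]
  congr 1
  · module
  · simp only [add_comm]

theorem commute_diagElt_offElt [Fintype κ] (c : ℝ) (i i' j : κ) (u : κ → B)
    (h : ∀ l l', Commute (u l) (u l')) (h' : ∀ l l', Commute (u l) (star (u l'))) :
    Commute (diagElt c i u) (offElt i' j u) := by
  have hs : ∀ l l', Commute (star (u l)) (star (u l')) := fun l l' => (h l l').star_star
  have him : ∀ (b : B) (l : κ), Commute b (u l) → Commute b (star (u l)) →
      Commute b (imElt (u l)) := fun b l h1 h2 => (h1.sub_right h2).smul_right _
  have him2 : ∀ (b : B) (l : κ), Commute b (u l) → Commute b (star (u l)) →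
      Commute (imElt (u l)) b := fun b l h1 h2 => (him b l h1 h2).symm
  have hoff : ∀ b : B, (∀ l, Commute b (u l)) → (∀ l, Commute b (star (u l))) →
      Commute b (offElt i' j u) := fun b h1 h2 =>
    (him b i' (h1 _) (h2 _)).sub_right ((him b j (h1 _) (h2 _)).smul_right _)
  have hu : ∀ l, Commute (u l) (offElt i' j u) := fun l => hoff _ (h l) (h' l)
  have hsu : ∀ l, Commute (star (u l)) (offElt i' j u) := fun l =>
    hoff _ (fun l' => (h' l' l).symm) (hs l)
  refine Commute.add_left (((hu i).sub_left (hsu i)).smul_left _) (Commute.smul_left ?_ _)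
  exact Commute.sum_left _ _ _ fun l _ => (Commute.one_left _).sub_left
    (((hu l).add_left (hsu l)).smul_left _)

end Algebraic

variable {B : Type*} [CStarAlgebra B]

theorem norm_imElt_sub_le (a b : B) : ‖imElt a - imElt b‖ ≤ ‖a - b‖ := by
  have h : imElt a - imElt b = (-(Complex.I / 2) : ℂ) • ((a - b) - star (a - b)) := by
    rw [imElt, imElt, ← smul_sub, star_sub]; congr 1; abel
  have h2 := norm_sub_le (a - b) (star (a - b))
  rw [norm_star] at h2
  rw [h, norm_smul, norm_neg, norm_div, Complex.norm_I, Complex.norm_ofNat]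
  linarith

/-- Real and imaginary parts are 1-Lipschitz: the imaginary part contributes 1, and each term of the
deviation contributes `c`. -/
theorem norm_diagElt_sub_le [Fintype κ] {c η : ℝ} (hc : 0 ≤ c) (i : κ) {u u' : κ → B}
    (h : ∀ l, ‖u l - u' l‖ ≤ η) :
    ‖diagElt c i u - diagElt c i u'‖ ≤ (1 + c * Fintype.card κ) * η := by
  have h1 : ‖devElt u - devElt u'‖ ≤ Fintype.card κ * η := by
    rw [devElt, devElt, ← Finset.sum_sub_distrib]
    refine (norm_sum_le _ _).trans ((Finset.sum_le_sum fun l _ => ?_).trans_eq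
      (by rw [Finset.sum_const, nsmul_eq_mul, Finset.card_univ] : ∑ l : κ, η = _))
    have h3 : 1 - (1 / 2 : ℂ) • (u l + star (u l)) - (1 - (1 / 2 : ℂ) • (u' l + star (u' l))) =
        -((1 / 2 : ℂ) • ((u l - u' l) + star (u l - u' l))) := by
      rw [star_sub]; module
    have h2 := norm_add_le (u l - u' l) (star (u l - u' l))
    rw [norm_star] at h2
    rw [h3, norm_neg, norm_smul, norm_div, norm_one, Complex.norm_ofNat]
    linarith [h l]
  have h2 : diagElt c i u - diagElt c i u' =
      (imElt (u i) - imElt (u' i)) + (c : ℂ) • (devElt u - devElt u') := by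
    rw [diagElt, diagElt, smul_sub]; abel
  rw [h2]
  refine (norm_add_le _ _).trans ?_
  rw [norm_smul, Complex.norm_real, Real.norm_of_nonneg hc]
  have h3 := (norm_imElt_sub_le (u i) (u' i)).trans (h i)
  have h4 := mul_le_mul_of_nonneg_left h1 hc
  linarith

theorem norm_offElt_sub_le {η : ℝ} (i j : κ) {u u' : κ → B} (h : ∀ l, ‖u l - u' l‖ ≤ η) :
    ‖offElt i j u - offElt i j u'‖ ≤ 2 * η := by
  have h2 : offElt i j u - offElt i j u' =
      (imElt (u i) - imElt (u' i)) - Complex.I • (imElt (u j) - imElt (u' j)) := by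
    rw [offElt, offElt, smul_sub]; abel
  rw [h2]
  refine (norm_sub_le _ _).trans ?_
  rw [norm_smul, Complex.norm_I]
  have h3 := (norm_imElt_sub_le (u i) (u' i)).trans (h i)
  have h4 := (norm_imElt_sub_le (u j) (u' j)).trans (h j)
  linarith

/-- The test element at scalars. -/
theorem diagElt_scalar [Fintype κ] (c : ℝ) (i : κ) (z : κ → ℂ) :
    diagElt c i (fun l => z l • (1 : B)) =
      (((z i).im + c * ∑ l, (1 - (z l).re) : ℝ) : ℂ) • (1 : B) := by
  have h1 : ∀ w : ℂ, imElt (w • (1 : B)) = (w.im : ℂ) • (1 : B) := by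
    intro w
    rw [imElt, star_smul, star_one, ← sub_smul, smul_smul]
    congr 1
    rw [Complex.star_def, Complex.sub_conj]
    push_cast
    linear_combination (-(w.im : ℂ)) * Complex.I_mul_I
  have h2 : ∀ w : ℂ, 1 - (1 / 2 : ℂ) • (w • (1 : B) + star (w • (1 : B))) =
      ((1 - w.re : ℝ) : ℂ) • (1 : B) := by
    intro w
    rw [star_smul, star_one, ← add_smul, smul_smul, Complex.star_def, Complex.add_conj]
    push_cast
    module
  rw [diagElt, devElt, h1]
  simp only [h2]
  rw [← Finset.sum_smul, smul_smul, ← add_smul]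
  push_cast
  rfl

/-- The imaginary part of an infinitesimal unitary. -/
theorem imElt_one_add {A : B} (hA : IsSelfAdjoint A) (t : ℝ) :
    imElt (1 + (t * Complex.I : ℂ) • A) = (t : ℂ) • A := by
  rw [imElt, star_add, star_one, star_smul, hA.star_eq]
  have : star (t * Complex.I : ℂ) = -(t * Complex.I) := by simp
  rw [this]
  have h : (1 + (t * Complex.I : ℂ) • A - (1 + (-(t * Complex.I) : ℂ) • A)) =
      (2 * t * Complex.I : ℂ) • A := by module
  rw [h, smul_smul]
  congr 1
  linear_combination (-(t : ℂ)) * Complex.I_mul_I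

/-- The real part of `1 + itA` is 1, so the deviation term has no first-order effect on the spin
blocks, however large its coefficient. -/
theorem devElt_one_add [Fintype κ] {A : κ → B} (hA : ∀ l, IsSelfAdjoint (A l)) (t : ℝ) :
    devElt (fun l => 1 + (t * Complex.I : ℂ) • A l) = 0 := by
  refine Finset.sum_eq_zero fun l _ => ?_
  rw [star_add, star_one, star_smul, (hA l).star_eq]
  have : star (t * Complex.I : ℂ) = -(t * Complex.I) := by simp
  rw [this]
  module

end TestElements

/-! ### Asymptotically commuting unitaries from spin matrices -/

section SpinSequences

open Matrix Module

variable (n : ℕ)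

/-- On the spin subspace the unperturbed form is `t` times the squared norm, and the perturbation
costs at most `η`. -/
theorem le_pairForm_of_near_spin {D K : Matrix (Fin (n + 2)) (Fin (n + 2)) ℂ} {t η δ : ℝ}
    (hD : ‖D - (t : ℂ) • spinZ n‖ + ‖K - (t : ℂ) • star (spinM n)‖ ≤ η) (h : δ + η ≤ t) :
    ∀ p ∈ spinSubspace n, δ * (normSqVec p.1 + normSqVec p.2) ≤ pairForm D K p.1 p.2 := by
  intro p hp
  have h1 := abs_pairForm_le (D - (t : ℂ) • spinZ n) (K - (t : ℂ) • star (spinM n)) p.1 p.2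
  have h2 : pairForm ((t : ℂ) • spinZ n) ((t : ℂ) • star (spinM n)) p.1 p.2 =
      t * pairForm (spinZ n) (star (spinM n)) p.1 p.2 := by
    simp only [pairForm, smul_mulVec, dotProduct_smul, smul_eq_mul, Complex.re_ofReal_mul]
    ring
  rw [pairForm_sub, h2, pairForm_spin hp, abs_le] at h1
  have h3 := add_nonneg (normSqVec_nonneg p.1) (normSqVec_nonneg p.2)
  have h4 := mul_le_mul_of_nonneg_right hD h3
  have h5 := mul_le_mul_of_nonneg_right h h3
  linarith [h1.1]

/-- On vectors `(v, 0)` the form sees only `D`, so nothing is asked of `K`. -/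
theorem le_pairForm_of_near_scalar {ν : Type*} [Fintype ν] [DecidableEq ν] {D : Matrix ν ν ℂ}
    (K : Matrix ν ν ℂ) {r η δ : ℝ} (hD : ‖D - (r : ℂ) • 1‖ ≤ η) (h : δ + η ≤ r) :
    ∀ p ∈ LinearMap.ker (LinearMap.snd ℂ (ν → ℂ) (ν → ℂ)),
      δ * (normSqVec p.1 + normSqVec p.2) ≤ pairForm D K p.1 p.2 := by
  rintro ⟨v, w⟩ hp
  have hw : w = 0 := hp
  subst hw
  have h0 : normSqVec (0 : ν → ℂ) = 0 := normSqVec_eq_zero.2 rfl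
  have h1 := (Complex.abs_re_le_norm _).trans (norm_dotProduct_mulVec_le (D - (r : ℂ) • 1) v v)
  have h2 : (star v ⬝ᵥ ((D - (r : ℂ) • (1 : Matrix ν ν ℂ)) *ᵥ v)).re =
      (star v ⬝ᵥ (D *ᵥ v)).re - r * normSqVec v := by
    rw [sub_mulVec, dotProduct_sub, smul_mulVec, one_mulVec, dotProduct_smul, Complex.sub_re,
      smul_eq_mul, Complex.re_ofReal_mul, normSqVec]
  rw [h2, abs_le] at h1
  have h3 := normSqVec_nonneg v
  have h4 := mul_le_mul_of_nonneg_right hD h3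
  have h5 := mul_le_mul_of_nonneg_right h h3
  simp only [pairForm, mulVec_zero, dotProduct_zero, Complex.zero_re, h0]
  linarith [h1.1]

theorem finrank_ker_snd {ν : Type*} [Fintype ν] :
    finrank ℂ (LinearMap.ker (LinearMap.snd ℂ (ν → ℂ) (ν → ℂ))) = Fintype.card ν := by
  have h := (LinearMap.snd ℂ (ν → ℂ) (ν → ℂ)).finrank_range_add_finrank_ker
  rw [LinearMap.range_eq_top.2 Prod.snd_surjective, finrank_top, finrank_prod,
    finrank_fintype_fun_eq_card] at h
  omega

/-- The dimensions of the spin representations. -/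
abbrev spinDim (n : ℕ) : ℕ := n + 2

/-- The sequence of the normalized weight operators. -/
def spinSeqZ : MatrixProd spinDim :=
  ⟨fun n => spinZ n, memℓp_infty ⟨1, by rintro _ ⟨n, rfl⟩; exact norm_spinZ_le n⟩⟩

/-- The sequence of the normalized raising operators. -/
def spinSeqM : MatrixProd spinDim :=
  ⟨fun n => spinM n, memℓp_infty ⟨2, by rintro _ ⟨n, rfl⟩; exact norm_spinM_le n⟩⟩

theorem norm_spinSeqZ_le : ‖spinSeqZ‖ ≤ 2 :=
  lp.norm_le_of_forall_le two_pos.le fun n => (norm_spinZ_le n).trans one_le_two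

theorem norm_spinSeqM_le : ‖spinSeqM‖ ≤ 2 :=
  lp.norm_le_of_forall_le two_pos.le fun n => norm_spinM_le n

theorem star_spinSeqZ : star spinSeqZ = spinSeqZ :=
  lp.ext (funext fun n => star_spinZ n)

theorem commute_coronaMk_spinSeqZ_spinSeqM :
    Commute (coronaMk spinDim spinSeqZ) (coronaMk spinDim spinSeqM) := by
  rw [commute_iff_eq, ← map_mul, ← map_mul, coronaMk_eq_iff]
  exact squeeze_zero (fun n => norm_nonneg _) norm_spinZ_mul_spinM_sub_le tendsto_spin_inv

theorem commute_coronaMk_spinSeqM_star :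
    Commute (coronaMk spinDim spinSeqM) (coronaMk spinDim (star spinSeqM)) := by
  rw [commute_iff_eq, ← map_mul, ← map_mul, coronaMk_eq_iff]
  exact squeeze_zero (fun n => norm_nonneg _) norm_spinM_mul_star_sub_le tendsto_spin_inv

/-- The real part of an element of a `*`-algebra. -/
def reElt {B : Type*} [Ring B] [StarRing B] [Algebra ℂ B] (b : B) : B := (1 / 2 : ℂ) • (b + star b)

/-- The sequences of the three spin operators, normalized. -/
def spinSeq : Fin 3 → MatrixProd spinDim := ![reElt spinSeqM, imElt spinSeqM, spinSeqZ]

theorem isSelfAdjoint_spinSeq (i : Fin 3) : IsSelfAdjoint (spinSeq i) := by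
  have h1 : star (1 / 2 : ℂ) = 1 / 2 := by simp
  have h2 : star (-(Complex.I / 2)) = Complex.I / 2 := by simp [neg_div]
  fin_cases i
  · change star (reElt spinSeqM) = reElt spinSeqM
    rw [reElt, star_smul, star_add, star_star, h1, add_comm]
  · change star (imElt spinSeqM) = imElt spinSeqM
    rw [imElt, star_smul, star_sub, star_star, h2]
    module
  · exact star_spinSeqZ

theorem norm_spinSeq_le (i : Fin 3) : ‖spinSeq i‖ ≤ 2 := by
  have h := norm_spinSeqM_le
  fin_cases i
  · change ‖reElt spinSeqM‖ ≤ 2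
    have := norm_add_le spinSeqM (star spinSeqM)
    rw [norm_star] at this
    rw [reElt, norm_smul, norm_div, norm_one, Complex.norm_ofNat]
    linarith
  · change ‖imElt spinSeqM‖ ≤ 2
    have := norm_imElt_sub_le spinSeqM 0
    rw [show imElt (0 : MatrixProd spinDim) = 0 by simp [imElt], sub_zero, sub_zero] at this
    exact this.trans h
  · exact norm_spinSeqZ_le

/-- This explains the shape of `offElt`: from the first two spin operators it recovers the
off-diagonal entry `M*`. -/
theorem spinSeq_sub : spinSeq 0 - Complex.I • spinSeq 1 = star spinSeqM := by
  change reElt spinSeqM - Complex.I • imElt spinSeqM = _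
  rw [reElt, imElt, smul_smul, mul_neg, mul_div_assoc', Complex.I_mul_I]
  module

theorem commute_coronaMk_spinSeq (i j : Fin 3) :
    Commute (coronaMk spinDim (spinSeq i)) (coronaMk spinDim (spinSeq j)) := by
  have hMM := commute_coronaMk_spinSeqM_star
  have hZM := commute_coronaMk_spinSeqZ_spinSeqM
  have hZM' : Commute (coronaMk spinDim spinSeqZ) (coronaMk spinDim (star spinSeqM)) := by
    have h := hZM.star_star
    rwa [star_coronaMk, star_coronaMk, star_spinSeqZ] at h
  have key : ∀ x : MatrixCorona spinDim, Commute x (coronaMk spinDim spinSeqM) →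
      Commute x (coronaMk spinDim (star spinSeqM)) → Commute x (coronaMk spinDim spinSeqZ) →
      ∀ i, Commute x (coronaMk spinDim (spinSeq i)) := by
    intro x h1 h2 h3 i
    fin_cases i
    · change Commute x (coronaMk spinDim (reElt spinSeqM))
      rw [reElt, map_smul, map_add]
      exact (h1.add_right h2).smul_right _
    · change Commute x (coronaMk spinDim (imElt spinSeqM))
      rw [imElt, map_smul, map_sub]
      exact (h1.sub_right h2).smul_right _
    · exact h3
  exact key _ (key _ (Commute.refl _) hMM hZM.symm i).symm
    (key _ hMM.symm (Commute.refl _) hZM'.symm i).symm (key _ hZM hZM' (Commute.refl _) i).symm j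

theorem exists_spin_unitaries {ε : ℝ} (hε : 0 < ε) (hε8 : ε ≤ 1 / 8) :
    ∃ V : Fin 3 → unitary (MatrixProd spinDim),
      (∀ i j, Commute (coronaMk spinDim (V i)) (coronaMk spinDim (V j))) ∧
      (∀ i, ‖(V i : MatrixProd spinDim) - 1‖ ≤ 8 * ε) ∧
      ∀ i, ∀ k : ℕ, 1 ≤ k → ‖(V i : MatrixProd spinDim) ^ k - 1 -
        (2 * k * ε * Complex.I : ℂ) • spinSeq i‖ ≤ 80 * k ^ 2 * ε ^ 2 := by
  choose V h1 h2 h3 using fun i =>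
    exists_unitary_near_exp (isSelfAdjoint_spinSeq i) (norm_spinSeq_le i) hε hε8
  refine ⟨V, fun i j => ?_, h1, h2⟩
  -- Commutation passes from the operators to their Cayley transforms one factor at a time.
  have h4 : ∀ i j, Commute (coronaMk spinDim (spinSeq i)) (coronaMk spinDim (V j)) :=
    fun i j => h3 j (coronaMk spinDim) _ (commute_coronaMk_spinSeq i j)
  exact h3 j (coronaMk spinDim) _ (h4 j i).symm

end SpinSequences

/-! ### Block matrices with entries in a bounded product of matrix algebras -/

section Blocks

open Matrix

/-! ### Block matrices over one matrix algebra -/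

section Single

variable {X ν ι : Type*} [Fintype X] [DecidableEq X] [Fintype ν] [DecidableEq ν] [Fintype ι]
  [DecidableEq ι] (e : X × ν ≃ ι)

/-- Block matrices as matrices. -/
def blockEquiv : Matrix X X (Matrix ν ν ℂ) ≃ₐ[ℂ] Matrix ι ι ℂ :=
  (compAlgEquiv X ν ℂ ℂ).trans (reindexAlgEquiv ℂ ℂ e)

theorem blockEquiv_apply (M : Matrix X X (Matrix ν ν ℂ)) :
    blockEquiv e M = reindex e e (comp X X ν ν ℂ M) := rfl

theorem blockEquiv_star (M : Matrix X X (Matrix ν ν ℂ)) :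
    blockEquiv e (star M) = star (blockEquiv e M) := rfl

/-- By the C*-identity, an off-diagonal block reduces to a diagonal corner, whose inclusion is a
`*`-homomorphism and hence contractive. -/
theorem norm_blockEquiv_single_le (x y : X) (b : Matrix ν ν ℂ) :
    ‖blockEquiv e (single x y b)‖ ≤ ‖b‖ := by
  let f : Matrix ν ν ℂ →⋆ₙₐ[ℂ] Matrix ι ι ℂ :=
    { toFun := fun b => blockEquiv e (single y y b)
      map_zero' := by simp
      map_add' := fun a b => by rw [single_add, map_add]
      map_mul' := fun a b => by rw [← map_mul, single_mul_single_same]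
      map_smul' := fun c b => by rw [← smul_single, map_smul]; rfl
      map_star' := fun b => by
        rw [← blockEquiv_star, star_eq_conjTranspose (single y y b), conjTranspose_single] }
  have h1 : ‖f (star b * b)‖ ≤ ‖star b * b‖ := NonUnitalStarAlgHom.norm_apply_le f _
  have h2 : f (star b * b) =
      star (blockEquiv e (single x y b)) * blockEquiv e (single x y b) := by
    rw [← blockEquiv_star, ← map_mul, star_eq_conjTranspose (single x y b), conjTranspose_single,
      single_mul_single_same]
    rfl
  rw [h2, CStarRing.norm_star_mul_self, CStarRing.norm_star_mul_self] at h1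
  exact abs_le_of_sq_le_sq' (by rwa [sq, sq]) (norm_nonneg _) |>.2

theorem norm_blockEquiv_le (M : Matrix X X (Matrix ν ν ℂ)) :
    ‖blockEquiv e M‖ ≤ ∑ x, ∑ y, ‖M x y‖ := by
  conv_lhs => rw [matrix_eq_sum_single M]
  simp only [map_sum]
  exact (norm_sum_le _ _).trans (Finset.sum_le_sum fun x _ => (norm_sum_le _ _).trans
    (Finset.sum_le_sum fun y _ => norm_blockEquiv_single_le e x y _))

theorem norm_reindex_symm_le (A : Matrix ι ι ℂ) : ‖reindex e.symm e.symm A‖ ≤ ‖A‖ := by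
  let f : Matrix ι ι ℂ →⋆ₙₐ[ℂ] Matrix (X × ν) (X × ν) ℂ :=
    { (reindexAlgEquiv ℂ ℂ e.symm : Matrix ι ι ℂ →ₐ[ℂ] Matrix (X × ν) (X × ν) ℂ) with
      map_zero' := map_zero (reindexAlgEquiv ℂ ℂ e.symm)
      map_star' := fun _ => rfl
      map_smul' := map_smul (reindexAlgEquiv ℂ ℂ e.symm) }
  exact NonUnitalStarAlgHom.norm_apply_le f A

end Single

variable {X : Type*} [Fintype X] (k : ℕ → ℕ) [∀ n, NeZero (k n)]

/-- The dimensions of direct sums of copies of `ℂ^(k n)`. -/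
def blockDim (X : Type*) [Fintype X] (k : ℕ → ℕ) (n : ℕ) : ℕ := Fintype.card X * k n

/-- An enumeration of the basis of a direct sum of copies of `ℂ^(k n)`. -/
def blockIndex (X : Type*) [Fintype X] (k : ℕ → ℕ) (n : ℕ) :
    X × Fin (k n) ≃ Fin (blockDim X k n) :=
  ((Fintype.equivFin X).prodCongr (Equiv.refl _)).trans finProdFinEquiv

instance instNeZeroBlockDim [Nonempty X] (n : ℕ) : NeZero (blockDim X k n) :=
  ⟨mul_ne_zero Fintype.card_ne_zero (NeZero.ne _)⟩

variable [DecidableEq X] [Nonempty X]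

/-- The sequence of matrices given by a matrix of sequences of matrices. -/
def blockSeq : Matrix X X (MatrixProd k) →ₐ[ℂ] MatrixProd (blockDim X k) where
  toFun M := ⟨fun n => blockEquiv (blockIndex X k n) (M.map fun b => b n), memℓp_infty
    ⟨∑ x, ∑ y, ‖M x y‖, by
      rintro _ ⟨n, rfl⟩
      exact (norm_blockEquiv_le _ _).trans (Finset.sum_le_sum fun x _ => Finset.sum_le_sum
        fun y _ => lp.norm_apply_le_norm ENNReal.top_ne_zero (M x y) n)⟩⟩
  map_one' := by
    refine lp.ext (funext fun n => ?_)
    change blockEquiv (blockIndex X k n) ((1 : Matrix X X (MatrixProd k)).map fun b => b n) = 1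
    rw [Matrix.map_one _ rfl rfl, map_one]
  map_mul' M M' := by
    refine lp.ext (funext fun n => ?_)
    change blockEquiv (blockIndex X k n) ((M * M').map fun b => b n) =
      blockEquiv (blockIndex X k n) (M.map fun b => b n) *
        blockEquiv (blockIndex X k n) (M'.map fun b => b n)
    rw [← map_mul]
    congr 1
    ext x y : 2
    simp only [map_apply, mul_apply]
    rw [lp.coeFn_sum, Finset.sum_apply]
    rfl
  map_zero' := by
    refine lp.ext (funext fun n => ?_)
    change blockEquiv (blockIndex X k n) ((0 : Matrix X X (MatrixProd k)).map fun b => b n) = 0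
    rw [Matrix.map_zero _ rfl, map_zero]
  map_add' M M' := by
    refine lp.ext (funext fun n => ?_)
    change blockEquiv (blockIndex X k n) ((M + M').map fun b => b n) =
      blockEquiv (blockIndex X k n) (M.map fun b => b n) +
        blockEquiv (blockIndex X k n) (M'.map fun b => b n)
    rw [← map_add]
    rfl
  commutes' c := by
    refine lp.ext (funext fun n => ?_)
    change blockEquiv (blockIndex X k n)
      ((algebraMap ℂ (Matrix X X (MatrixProd k)) c).map fun b => b n) = algebraMap ℂ _ c
    rw [← AlgEquiv.commutes (blockEquiv (blockIndex X k n)) c]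
    congr 1
    ext x y : 2
    simp only [map_apply, algebraMap_matrix_apply]
    split_ifs <;> rfl

theorem blockSeq_apply (M : Matrix X X (MatrixProd k)) (n : ℕ) :
    blockSeq k M n = blockEquiv (blockIndex X k n) (M.map fun b => b n) := rfl

theorem blockSeq_star (M : Matrix X X (MatrixProd k)) :
    blockSeq k (star M) = star (blockSeq k M) := rfl

/-- The number of blocks does not depend on `n`, so the crude bound by the sum of the entry norms
suffices. -/
theorem coronaMk_blockSeq_congr {M M' : Matrix X X (MatrixProd k)}
    (h : ∀ x y, coronaMk k (M x y) = coronaMk k (M' x y)) :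
    coronaMk (blockDim X k) (blockSeq k M) = coronaMk (blockDim X k) (blockSeq k M') := by
  rw [coronaMk_eq_iff]
  have h0 : Tendsto (fun n => ∑ x : X, ∑ y : X, ‖M x y n - M' x y n‖) atTop (𝓝 0) := by
    have := tendsto_finsetSum Finset.univ fun x _ => tendsto_finsetSum Finset.univ fun y _ =>
      (coronaMk_eq_iff k).1 (h x y)
    simpa only [Finset.sum_const_zero] using this
  refine squeeze_zero (fun n => norm_nonneg _) (fun n => ?_) h0
  rw [blockSeq_apply, blockSeq_apply, ← map_sub]
  exact norm_blockEquiv_le _ _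

end Blocks

/-! ### Induced asymptotic representations -/

section Induction

open Matrix

variable {G : Type u} [Group G] (A : Subgroup G)

/-- The cocycle of the action of `G` on `G ⧸ A` for a choice of representatives. -/
def cosetCocycle (g : G) (x : G ⧸ A) : A :=
  ⟨(g • x).out⁻¹ * (g * x.out), by
    rw [← QuotientGroup.eq, QuotientGroup.out_eq']
    conv_lhs => rw [← QuotientGroup.out_eq' x]
    rfl⟩

theorem coe_cosetCocycle (g : G) (x : G ⧸ A) :
    (cosetCocycle A g x : G) = (g • x).out⁻¹ * (g * x.out) := rfl

/-- The cocycle identity is what makes the induced matrices multiplicative. -/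
theorem cosetCocycle_mul (g g' : G) (x : G ⧸ A) :
    cosetCocycle A (g * g') x = cosetCocycle A g (g' • x) * cosetCocycle A g' x := by
  ext
  rw [Subgroup.coe_mul, coe_cosetCocycle, coe_cosetCocycle, coe_cosetCocycle, mul_smul]
  group

/-- As `A` acts trivially on `G ⧸ A`, its elements induce block diagonal matrices, whose blocks are
the values of `ϕ` at conjugates. -/
theorem smul_coset_of_mem [A.Normal] (a : A) (x : G ⧸ A) : (a : G) • x = x := by
  obtain ⟨g, rfl⟩ := QuotientGroup.mk_surjective x
  rw [MulAction.Quotient.smul_mk, smul_eq_mul, eq_comm, QuotientGroup.eq, ← mul_assoc]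
  simpa using ‹A.Normal›.conj_mem a a.2 g⁻¹

theorem coe_cosetCocycle_of_mem [A.Normal] (a : A) (x : G ⧸ A) :
    (cosetCocycle A a x : G) = x.out⁻¹ * (a * x.out) := by
  rw [coe_cosetCocycle, smul_coset_of_mem]

variable {A} [DecidableEq (G ⧸ A)]

/-! ### Monomial matrices of induced representations -/

section Monomial

variable {B : Type*} [CStarAlgebra B]

/-- The monomial matrix of the induced representation. -/
def inducedMatrix (ϕ : A → unitary B) (g : G) : Matrix (G ⧸ A) (G ⧸ A) B :=
  Matrix.of fun y x => if y = g • x then (ϕ (cosetCocycle A g x) : B) else 0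

theorem inducedMatrix_apply (ϕ : A → unitary B) (g : G) (y x : G ⧸ A) :
    inducedMatrix ϕ g y x = if y = g • x then (ϕ (cosetCocycle A g x) : B) else 0 := rfl

/-- Unitarity is exact and uses only that the values of `ϕ` are unitary; multiplicativity will hold
only in the corona. -/
theorem star_inducedMatrix_mul_self [Fintype (G ⧸ A)] (ϕ : A → unitary B) (g : G) :
    star (inducedMatrix ϕ g) * inducedMatrix ϕ g = 1 := by
  ext x x'
  simp only [mul_apply, star_apply, inducedMatrix_apply, mul_ite, mul_zero, Finset.sum_ite_eq',
    Finset.mem_univ, if_true, smul_left_cancel_iff]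
  by_cases h : x' = x
  · subst h; simp
  · rw [if_neg h, one_apply_ne (Ne.symm h), star_zero, zero_mul]

theorem inducedMatrix_mul_star_self [Fintype (G ⧸ A)] (ϕ : A → unitary B) (g : G) :
    inducedMatrix ϕ g * star (inducedMatrix ϕ g) = 1 := by
  ext y y'
  rw [mul_apply, Finset.sum_eq_single (g⁻¹ • y)]
  · rw [star_apply, inducedMatrix_apply, inducedMatrix_apply, smul_inv_smul, if_pos rfl]
    by_cases h : y' = y
    · subst h; simp
    · rw [if_neg h, one_apply_ne (Ne.symm h), star_zero, mul_zero]
  · intro x _ hx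
    rw [inducedMatrix_apply, if_neg, zero_mul]
    rintro rfl
    exact hx (inv_smul_smul g x).symm
  · simp

theorem inducedMatrix_of_mem [A.Normal] (ϕ : A → unitary B) (a : A) :
    inducedMatrix ϕ (a : G) = diagonal fun x => (ϕ (cosetCocycle A a x) : B) := by
  ext y x
  rw [inducedMatrix_apply, smul_coset_of_mem, diagonal_apply]
  split_ifs with h
  · rw [h]
  · rfl

end Monomial

variable [Fintype (G ⧸ A)] (k : ℕ → ℕ) [∀ n, NeZero (k n)] (ϕ : A → unitary (MatrixProd k))

theorem coronaMk_blockSeq_inducedMatrix_mul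
    (hϕ : ∀ a b, coronaMk k (ϕ (a * b) : MatrixProd k) =
      coronaMk k (ϕ a : MatrixProd k) * coronaMk k (ϕ b : MatrixProd k)) (g g' : G) :
    coronaMk (blockDim (G ⧸ A) k) (blockSeq k (inducedMatrix ϕ (g * g'))) =
      coronaMk (blockDim (G ⧸ A) k) (blockSeq k (inducedMatrix ϕ g)) *
        coronaMk (blockDim (G ⧸ A) k) (blockSeq k (inducedMatrix ϕ g')) := by
  rw [← map_mul (coronaMk _), ← map_mul (blockSeq k)]
  refine coronaMk_blockSeq_congr k fun y x => ?_
  simp only [mul_apply, inducedMatrix_apply, mul_ite, mul_zero, Finset.sum_ite_eq',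
    Finset.mem_univ, if_true, mul_smul]
  split_ifs with h
  · rw [cosetCocycle_mul, hϕ, map_mul]
  · simp

theorem coronaMk_blockSeq_mem_unitary {X : Type*} [Fintype X] [DecidableEq X] [Nonempty X]
    {M : Matrix X X (MatrixProd k)} (h1 : star M * M = 1) (h2 : M * star M = 1) :
    coronaMk (blockDim X k) (blockSeq k M) ∈ unitary (MatrixCorona (blockDim X k)) := by
  have h3 : star (coronaMk (blockDim X k) (blockSeq k M)) = coronaMk (blockDim X k) (blockSeq k (star M)) := rfl
  rw [Unitary.mem_iff, h3]
  constructor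
  · rw [← map_mul (coronaMk (blockDim X k)), ← map_mul (blockSeq k), h1, map_one, map_one]
  · rw [← map_mul (coronaMk (blockDim X k)), ← map_mul (blockSeq k), h2, map_one, map_one]

/-- The representation in the corona induced by an asymptotic representation of `A`. -/
def inducedRep (hϕ : ∀ a b, coronaMk k (ϕ (a * b) : MatrixProd k) =
      coronaMk k (ϕ a : MatrixProd k) * coronaMk k (ϕ b : MatrixProd k)) : G →* unitary (MatrixCorona (blockDim (G ⧸ A) k)) :=
  MonoidHom.mk' (fun g => ⟨coronaMk (blockDim (G ⧸ A) k) (blockSeq k (inducedMatrix ϕ g)),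
    coronaMk_blockSeq_mem_unitary k (star_inducedMatrix_mul_self ϕ g)
      (inducedMatrix_mul_star_self ϕ g)⟩)
    fun g g' => Subtype.ext (coronaMk_blockSeq_inducedMatrix_mul k ϕ hϕ g g')

theorem coe_inducedRep (hϕ : ∀ a b, coronaMk k (ϕ (a * b) : MatrixProd k) =
      coronaMk k (ϕ a : MatrixProd k) * coronaMk k (ϕ b : MatrixProd k)) (g : G) : (inducedRep k ϕ hϕ g : MatrixCorona (blockDim (G ⧸ A) k)) =
    coronaMk (blockDim (G ⧸ A) k) (blockSeq k (inducedMatrix ϕ g)) := rfl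

end Induction

/-! ### Asymptotic representations of free abelian groups -/

section FreeAbelian

open Module

/-- For rationally independent `t₀, …, t_m`, take `z ↦ exp(2πi ∑ z_l t_{l+1} / t₀)`: an element of
the kernel gives a rational relation among the `t`. Injectivity is what separates an element of `A`
from its other conjugates. -/
theorem exists_injective_circle_character (m : ℕ) :
    ∃ χ : Multiplicative (Fin m → ℤ) →* Circle, Function.Injective χ := by
  obtain ⟨t, ht⟩ : ∃ t : Fin (m + 1) → ℝ, LinearIndependent ℚ t := by
    refine exists_linearIndependent_of_le_rank ?_
    rw [Real.rank_rat_real]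
    exact (Cardinal.natCast_lt_aleph0.trans Cardinal.aleph0_lt_continuum).le
  have ht0 : t 0 ≠ 0 := ht.ne_zero 0
  let χ : Multiplicative (Fin m → ℤ) →* Circle :=
    { toFun := fun z => Circle.exp (∑ l, (z.toAdd l : ℝ) * (t l.succ / t 0) * (2 * Real.pi))
      map_one' := by simp
      map_mul' := fun z z' => by
        rw [← Circle.exp_add, ← Finset.sum_add_distrib]
        congr 1
        refine Finset.sum_congr rfl fun l _ => ?_
        rw [toAdd_mul, Pi.add_apply]
        push_cast
        ring }
  refine ⟨χ, (injective_iff_map_eq_one χ).2 fun z hz => ?_⟩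
  obtain ⟨j, hj⟩ := Circle.exp_eq_one.1 hz
  rw [← Finset.sum_mul] at hj
  have hj2 := mul_right_cancel₀ (by positivity) hj
  have hj3 : ∑ l, (z.toAdd l : ℝ) * t l.succ = j * t 0 := by
    rw [← hj2, Finset.sum_mul]
    refine Finset.sum_congr rfl fun l _ => ?_
    field_simp
  have hrel : ∑ i, (Fin.cons (-j : ℚ) (fun l => (z.toAdd l : ℚ)) : Fin (m + 1) → ℚ) i • t i = 0 := by
    rw [Fin.sum_univ_succ]
    simp only [Fin.cons_zero, Fin.cons_succ, Rat.smul_def]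
    push_cast
    rw [hj3]
    ring
  have hz0 := Fintype.linearIndependent_iff.1 ht _ hrel
  apply Multiplicative.toAdd.injective
  ext l
  have := hz0 l.succ
  simpa using this

variable {B : Type*} [CStarAlgebra B]

theorem smul_one_mem_unitary (c : Circle) : (c : ℂ) • (1 : B) ∈ unitary B := by
  have h : star (c : ℂ) * c = 1 := by
    rw [Complex.star_def, ← Circle.coe_inv_eq_conj, ← Circle.coe_mul]; simp
  rw [Unitary.mem_iff, star_smul, star_one, smul_mul_smul_comm, smul_mul_smul_comm, one_mul,
    mul_comm (c : ℂ), h, one_smul]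
  exact ⟨rfl, rfl⟩

/-- The unitary scalars of a C*-algebra. -/
def circleUnitary (B : Type*) [CStarAlgebra B] : Circle →* unitary B where
  toFun c := ⟨(c : ℂ) • 1, smul_one_mem_unitary c⟩
  map_one' := Subtype.ext (by simp)
  map_mul' c c' := Subtype.ext (by
    change ((c * c' : Circle) : ℂ) • (1 : B) = ((c : ℂ) • 1) * ((c' : ℂ) • 1)
    rw [smul_mul_smul_comm, one_mul, Circle.coe_mul])

theorem coe_circleUnitary (c : Circle) : (circleUnitary B c : B) = (c : ℂ) • 1 := rfl

theorem norm_unitary_mul_sub_one_le (U V : unitary B) :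
    ‖((U * V : unitary B) : B) - 1‖ ≤ ‖(U : B) - 1‖ + ‖(V : B) - 1‖ := by
  have h : ((U * V : unitary B) : B) - 1 = (U - 1) * V + (V - 1) := by
    rw [Submonoid.coe_mul]; noncomm_ring
  rw [h]
  refine (norm_add_le _ _).trans (add_le_add_left ((norm_mul_le _ _).trans ?_) _)
  exact mul_le_of_le_one_right (norm_nonneg _) (norm_le_one_of_unitary V)

variable {m : ℕ} (i : Fin 3 → Fin m) (χ : Multiplicative (Fin m → ℤ) →* Circle)
  (V : Fin 3 → unitary B)

/-- The product of powers of three unitaries. -/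
def unitaryPowers (z : Fin m → ℤ) : unitary B := V 0 ^ z (i 0) * V 1 ^ z (i 1) * V 2 ^ z (i 2)

theorem norm_unitaryPowers_sub_one_le {η : ℝ} (hV : ∀ j, ‖(V j : B) - 1‖ ≤ η) (z : Fin m → ℤ) :
    ‖(unitaryPowers i V z : B) - 1‖ ≤ (∑ j, |(z (i j) : ℝ)|) * η := by
  rw [unitaryPowers, Fin.sum_univ_three]
  refine (norm_unitary_mul_sub_one_le _ _).trans ?_
  have h1 := norm_unitary_mul_sub_one_le (V 0 ^ z (i 0)) (V 1 ^ z (i 1))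
  have h2 : ∀ j, ‖((V j ^ z (i j) : unitary B) : B) - 1‖ ≤ |(z (i j) : ℝ)| * η := fun j =>
    (by exact_mod_cast norm_zpow_sub_one_le (V j) (z (i j)) :
      ‖((V j ^ z (i j) : unitary B) : B) - 1‖ ≤ |(z (i j) : ℝ)| * ‖(V j : B) - 1‖).trans
      (mul_le_mul_of_nonneg_left (hV j) (abs_nonneg _))
  linarith [h2 0, h2 1, h2 2]

/-- The product of a character with powers of three unitaries. -/
def twistedPowers (z : Multiplicative (Fin m → ℤ)) : unitary B :=
  circleUnitary B (χ z) * unitaryPowers i V z.toAdd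

theorem coe_twistedPowers (z : Multiplicative (Fin m → ℤ)) :
    (twistedPowers i χ V z : B) = (χ z : ℂ) • (unitaryPowers i V z.toAdd : B) := by
  rw [twistedPowers, Submonoid.coe_mul, coe_circleUnitary, smul_mul_assoc, one_mul]

theorem map_twistedPowers_mul {C : Type*} [Ring C] [Algebra ℂ C] (f : B →ₐ[ℂ] C)
    (hV : ∀ j j', Commute (f (V j)) (f (V j'))) (z z' : Multiplicative (Fin m → ℤ)) :
    f (twistedPowers i χ V (z * z')) = f (twistedPowers i χ V z) * f (twistedPowers i χ V z') := by
  -- Among units, negative exponents need no separate treatment. The product is rearranged there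
  -- because the `V j` commute only after `f`.
  let q : unitary B →* Cˣ := (Units.map (f : B →* C)).comp Unitary.toUnits
  have hq : ∀ U, (q U : C) = f U := fun U => rfl
  have hc : ∀ j j', Commute (q (V j)) (q (V j')) := fun j j' =>
    Units.ext (hV j j').eq
  have hs : ∀ (c : Circle) U, Commute U (q (circleUnitary B c)) := fun c U => by
    refine Units.ext ?_
    rw [Units.val_mul, Units.val_mul, hq, coe_circleUnitary, map_smul, map_one]
    simp
  have key : q (twistedPowers i χ V (z * z')) =
      q (twistedPowers i χ V z) * q (twistedPowers i χ V z') := by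
    simp only [twistedPowers, unitaryPowers, map_mul, map_zpow, toAdd_mul, Pi.add_apply, zpow_add]
    rw [(hs (χ z') _).mul_mul_mul_comm,
      Commute.mul_mul_mul_comm (b := q (V 2) ^ z.toAdd (i 2)),
      Commute.mul_mul_mul_comm (b := q (V 1) ^ z.toAdd (i 1))]
    · exact (hc 1 0).zpow_zpow _ _
    · exact ((hc 2 0).zpow_zpow _ _).mul_right ((hc 2 1).zpow_zpow _ _)
  rw [← hq, key, Units.val_mul, hq, hq]

end FreeAbelian

/-! ### The blocks of the test elements -/

section LocalForms

open Module

theorem re_lt_one_of_circle {c : Circle} (hc : c ≠ 1) : (c : ℂ).re < 1 := by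
  refine lt_of_le_of_ne ?_ fun h => hc ?_
  · exact (Complex.re_le_norm _).trans_eq (Circle.norm_coe c)
  · have h1 : Complex.normSq (c : ℂ) = 1 := by
      rw [Complex.normSq_eq_norm_sq, Circle.norm_coe, one_pow]
    rw [Complex.normSq_apply, h] at h1
    have h2 : (c : ℂ).im = 0 := by
      have : (c : ℂ).im * (c : ℂ).im = 0 := by linarith
      exact mul_self_eq_zero.1 this
    exact Circle.ext (Complex.ext h h2)

theorem re_le_one_of_circle (c : Circle) : (c : ℂ).re ≤ 1 :=
  (Complex.re_le_norm _).trans_eq (Circle.norm_coe c)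

theorem conj_smul_twistedPowers {B : Type*} [CStarAlgebra B] {m : ℕ} (i : Fin 3 → Fin m)
    (χ : Multiplicative (Fin m → ℤ) →* Circle) (V : Fin 3 → unitary B) (c : Circle)
    (z : Multiplicative (Fin m → ℤ)) :
    (conj (c : ℂ)) • (twistedPowers i χ V z : B) =
      ((c⁻¹ * χ z : Circle) : ℂ) • (unitaryPowers i V z.toAdd : B) := by
  rw [coe_twistedPowers, smul_smul, ← Circle.coe_inv_eq_conj, Circle.coe_mul]

/-- The spin operators, placed at three of the indices. -/
def spinFamily {m : ℕ} (i : Fin 3 → Fin m) (l : Fin m) : MatrixProd spinDim :=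
  if l = i 0 then spinSeq 0 else if l = i 1 then spinSeq 1 else if l = i 2 then spinSeq 2 else 0

variable {m : ℕ} {i : Fin 3 → Fin m}

theorem isSelfAdjoint_spinFamily (l : Fin m) : IsSelfAdjoint (spinFamily i l) := by
  unfold spinFamily
  split_ifs
  · exact isSelfAdjoint_spinSeq 0
  · exact isSelfAdjoint_spinSeq 1
  · exact isSelfAdjoint_spinSeq 2
  · exact IsSelfAdjoint.zero _

/-- For `Pi.single l L` at most one of the three powers is nontrivial; at indices outside the range
of `i` both the operator and the error vanish. -/
theorem norm_unitaryPowers_single_sub_le (hi : Function.Injective i)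
    {V : Fin 3 → unitary (MatrixProd spinDim)} {L : ℕ} {ε : ℝ}
    (hV : ∀ j, ‖(V j : MatrixProd spinDim) ^ L - 1 - (2 * L * ε * Complex.I : ℂ) • spinSeq j‖ ≤
      80 * L ^ 2 * ε ^ 2) (l : Fin m) :
    ‖(unitaryPowers i V (Pi.single l (L : ℤ)) : MatrixProd spinDim) -
      (1 + (((2 * L * ε : ℝ) : ℂ) * Complex.I) • spinFamily i l)‖ ≤ 80 * L ^ 2 * ε ^ 2 := by
  have h01 : i 0 ≠ i 1 := hi.ne (by decide)
  have h02 : i 0 ≠ i 2 := hi.ne (by decide)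
  have h12 : i 1 ≠ i 2 := hi.ne (by decide)
  push_cast
  by_cases h0 : l = i 0
  · subst h0
    simpa [unitaryPowers, spinFamily, Pi.single_apply, h01.symm, h02.symm, sub_sub] using hV 0
  by_cases h1 : l = i 1
  · subst h1
    simpa [unitaryPowers, spinFamily, Pi.single_apply, h01, h01.symm, h12.symm, sub_sub] using hV 1
  by_cases h2 : l = i 2
  · subst h2
    simpa [unitaryPowers, spinFamily, Pi.single_apply, h02, h12, h02.symm, h12.symm, sub_sub]
      using hV 2
  · have h : unitaryPowers i V (Pi.single l (L : ℤ)) = 1 := by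
      simp [unitaryPowers, Ne.symm h0, Ne.symm h1, Ne.symm h2]
    rw [h]
    simp only [spinFamily, if_neg h0, if_neg h1, if_neg h2, smul_zero, add_zero,
      Submonoid.coe_one, sub_self, norm_zero]
    positivity

theorem diagElt_spinFamily (hi : Function.Injective i) (c t : ℝ) :
    diagElt c (i 2) (fun l => 1 + (t * Complex.I : ℂ) • spinFamily i l) =
      (t : ℂ) • spinSeqZ := by
  have h02 : i 2 ≠ i 0 := hi.ne (by decide)
  have h12 : i 2 ≠ i 1 := hi.ne (by decide)
  rw [diagElt, devElt_one_add isSelfAdjoint_spinFamily, imElt_one_add (isSelfAdjoint_spinFamily _),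
    spinFamily, if_neg h02, if_neg h12, if_pos rfl, smul_zero, add_zero]
  rfl

theorem offElt_spinFamily (hi : Function.Injective i) (t : ℝ) :
    offElt (i 0) (i 1) (fun l => 1 + (t * Complex.I : ℂ) • spinFamily i l) =
      (t : ℂ) • star spinSeqM := by
  have h01 : i 1 ≠ i 0 := hi.ne (by decide)
  rw [offElt, imElt_one_add (isSelfAdjoint_spinFamily _),
    imElt_one_add (isSelfAdjoint_spinFamily _), spinFamily, if_pos rfl, spinFamily, if_neg h01,
    if_pos rfl, ← spinSeq_sub, smul_sub, smul_comm]

/-- Where the character is not moved, the form given by the test elements is positive on a subspace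
of more than half the dimension. -/
theorem exists_positive_subspace_of_spin (hi : Function.Injective i)
    {V : Fin 3 → unitary (MatrixProd spinDim)} {L : ℕ} {ε c : ℝ} (hε : 0 < ε) (hc : 0 ≤ c)
    (hV : ∀ j, ‖(V j : MatrixProd spinDim) ^ L - 1 - (2 * L * ε * Complex.I : ℂ) • spinSeq j‖ ≤
      80 * L ^ 2 * ε ^ 2) (hsmall : (3 + c * m) * (80 * L * ε) ≤ 1)
    {w : Fin m → MatrixProd spinDim}
    (hw : ∀ l, w l = (unitaryPowers i V (Pi.single l (L : ℤ)) : MatrixProd spinDim)) (n : ℕ) :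
    ∃ W : Submodule ℂ ((Fin (n + 2) → ℂ) × (Fin (n + 2) → ℂ)), n + 2 < finrank ℂ W ∧
      ∀ p ∈ W, (L * ε) * (normSqVec p.1 + normSqVec p.2) ≤
        pairForm (diagElt c (i 2) w n) (offElt (i 0) (i 1) w n) p.1 p.2 := by
  have hw' : ∀ l, ‖w l - (1 + (((2 * L * ε : ℝ) : ℂ) * Complex.I) • spinFamily i l)‖ ≤
      80 * L ^ 2 * ε ^ 2 := fun l => by
    rw [hw]; exact norm_unitaryPowers_single_sub_le hi hV l
  have hD := norm_diagElt_sub_le hc (i 2) hw'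
  have hK := norm_offElt_sub_le (i 0) (i 1) hw'
  rw [diagElt_spinFamily hi] at hD
  rw [offElt_spinFamily hi] at hK
  have hDn := (lp.norm_apply_le_norm ENNReal.top_ne_zero _ n).trans hD
  have hKn := (lp.norm_apply_le_norm ENNReal.top_ne_zero _ n).trans hK
  refine ⟨spinSubspace n, lt_finrank_spinSubspace n,
    le_pairForm_of_near_spin n (add_le_add hDn hKn) ?_⟩
  -- Here `t = 2Lε`. The errors `1 + cm` and `2` add up to `3 + cm` times `80L²ε²`, at most `Lε` by
  -- `hsmall`, which leaves `Lε` as the lower bound.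
  rw [Fintype.card_fin]
  have h1 : 0 ≤ (L : ℝ) * ε := by positivity
  have h2 := mul_le_mul_of_nonneg_left hsmall h1
  nlinarith

/-- Where the character is moved, the form given by the test elements is positive on a subspace of
half the dimension. -/
theorem exists_positive_subspace_of_scalar {V : Fin 3 → unitary (MatrixProd spinDim)}
    {ε c δ Z : ℝ} (hε : 0 < ε) (hc : 0 ≤ c)
    (hV : ∀ j, ‖(V j : MatrixProd spinDim) - 1‖ ≤ 8 * ε) {z : Fin m → Fin m → ℤ}
    (hz : ∀ l, ∑ j, |(z l (i j) : ℝ)| ≤ Z) (d : Fin m → Circle)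
    (hd : 2 ≤ c * ∑ l, (1 - (d l : ℂ).re))
    (hδ : δ + (1 + c * m) * (Z * (8 * ε)) ≤ 1)
    {w : Fin m → MatrixProd spinDim}
    (hw : ∀ l, w l = (d l : ℂ) • (unitaryPowers i V (z l) : MatrixProd spinDim)) (n : ℕ) :
    ∃ W : Submodule ℂ ((Fin (n + 2) → ℂ) × (Fin (n + 2) → ℂ)), n + 2 ≤ finrank ℂ W ∧
      ∀ p ∈ W, δ * (normSqVec p.1 + normSqVec p.2) ≤
        pairForm (diagElt c (i 2) w n) (offElt (i 0) (i 1) w n) p.1 p.2 := by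
  have hw' : ∀ l, ‖w l - (d l : ℂ) • 1‖ ≤ Z * (8 * ε) := fun l => by
    rw [hw, ← smul_sub, norm_smul, Circle.norm_coe, one_mul]
    exact (norm_unitaryPowers_sub_one_le i V hV (z l)).trans
      (mul_le_mul_of_nonneg_right (hz l) (by positivity))
  have hD := norm_diagElt_sub_le hc (i 2) hw'
  rw [diagElt_scalar, Fintype.card_fin] at hD
  have hDn := (lp.norm_apply_le_norm ENNReal.top_ne_zero _ n).trans hD
  refine ⟨_, (finrank_ker_snd.trans (Fintype.card_fin _)).ge,
    le_pairForm_of_near_scalar _ hDn ?_⟩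
  -- The scalar is at least `-1 + 2 = 1`: the deviation term outweighs any negative imaginary part.
  have h1 : |((d (i 2) : ℂ)).im| ≤ 1 := (Complex.abs_im_le_norm _).trans_eq (Circle.norm_coe _)
  rw [abs_le] at h1
  linarith [h1.1]

/-- A family of asymptotically commuting unitaries for which the forms given by the test elements
are positive on subspaces of at least half the dimension, and of more than half the dimension where
the character is not moved. -/
theorem exists_unitaries_positive (hi : Function.Injective i) {X : Type*} [Fintype X] {L : ℕ}
    (hL : 1 ≤ L) {χ : Multiplicative (Fin m → ℤ) →* Circle} (hχ : Function.Injective χ)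
    (z : X → Fin m → Multiplicative (Fin m → ℤ)) :
    ∃ (V : Fin 3 → unitary (MatrixProd spinDim)) (c δ : ℝ), 0 < δ ∧
      (∀ j j', Commute (coronaMk spinDim (V j)) (coronaMk spinDim (V j'))) ∧
      ∀ x n, ∃ W : Submodule ℂ ((Fin (n + 2) → ℂ) × (Fin (n + 2) → ℂ)),
        n + 2 ≤ finrank ℂ W ∧
        ((∀ l, z x l = Multiplicative.ofAdd (Pi.single l (L : ℤ))) → n + 2 < finrank ℂ W) ∧
        ∀ p ∈ W, δ * (normSqVec p.1 + normSqVec p.2) ≤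
          pairForm
            (diagElt c (i 2) (fun l => conj (χ (Multiplicative.ofAdd (Pi.single l (L : ℤ))) : ℂ) •
              (twistedPowers i χ V (z x l) : MatrixProd spinDim)) n)
            (offElt (i 0) (i 1)
              (fun l => conj (χ (Multiplicative.ofAdd (Pi.single l (L : ℤ))) : ℂ) •
                (twistedPowers i χ V (z x l) : MatrixProd spinDim)) n) p.1 p.2 := by
  set E : Fin m → Multiplicative (Fin m → ℤ) := fun l =>
    Multiplicative.ofAdd (Pi.single l (L : ℤ)) with hE
  -- By injectivity of `χ`, `d x l = 1` exactly when `z x l = E l`, so `S x` vanishes only where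
  -- every `E l` is fixed.
  set d : X → Fin m → Circle := fun x l => (χ (E l))⁻¹ * χ (z x l) with hd
  set S : X → ℝ := fun x => ∑ l, (1 - (d x l : ℂ).re) with hS
  have hS0 : ∀ x, 0 ≤ S x := fun x => Finset.sum_nonneg fun l _ =>
    sub_nonneg.2 (re_le_one_of_circle _)
  have hSpos : ∀ x, (¬ ∀ l, z x l = E l) → 0 < S x := by
    intro x hx
    push Not at hx
    obtain ⟨l, hl⟩ := hx
    refine Finset.sum_pos' (fun l _ => sub_nonneg.2 (re_le_one_of_circle _))
      ⟨l, Finset.mem_univ l, sub_pos.2 (re_lt_one_of_circle fun h => hl ?_)⟩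
    exact hχ (inv_mul_eq_one.1 h).symm
  -- Terms with `S x = 0` are 0 by the convention for division; the others make `c * S x ≥ 2`
  -- wherever `S x` is positive.
  set c : ℝ := ∑ x, 2 / S x with hc
  have hc0 : 0 ≤ c := Finset.sum_nonneg fun x _ => div_nonneg two_pos.le (hS0 x)
  have hcS : ∀ x, (¬ ∀ l, z x l = E l) → 2 ≤ c * S x := by
    intro x hx
    rw [← div_le_iff₀ (hSpos x hx)]
    exact Finset.single_le_sum (f := fun x => 2 / S x)
      (fun x _ => div_nonneg two_pos.le (hS0 x)) (Finset.mem_univ x)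
  set Z : ℝ := ∑ x, ∑ l, ∑ j, |(((z x l).toAdd (i j) : ℤ) : ℝ)| with hZ
  have hZ0 : 0 ≤ Z := by positivity
  have hzZ : ∀ x l, ∑ j, |(((z x l).toAdd (i j) : ℤ) : ℝ)| ≤ Z := by
    intro x l
    refine le_trans ?_ (Finset.single_le_sum (f := fun x => ∑ l, ∑ j,
      |(((z x l).toAdd (i j) : ℤ) : ℝ)|) (fun x _ => by positivity) (Finset.mem_univ x))
    exact Finset.single_le_sum (f := fun l => ∑ j,
      |(((z x l).toAdd (i j) : ℤ) : ℝ)|) (fun l _ => by positivity) (Finset.mem_univ l)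
  -- `T⁻¹` will be `ε`. The three summands serve `ε ≤ 1/8`, the error on the spin blocks and the
  -- error on the scalar blocks. Both `c` and `Z` depend only on `χ`, `z` and `i`, so `ε` may be
  -- chosen after them.
  set T : ℝ := 8 + (3 + c * m) * (80 * L) + (1 + c * m) * (Z * 16) with hT
  have hL1 : (1 : ℝ) ≤ L := by exact_mod_cast hL
  have ha : 0 ≤ c * m := by positivity
  have hb : 0 ≤ (1 + c * m) * (Z * 16) := by positivity
  have hb2 : 0 ≤ (3 + c * m) * (80 * L) := by positivity
  have hT0 : 0 < T := by linarith
  have hTε : T * T⁻¹ = 1 := mul_inv_cancel₀ hT0.ne'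
  have hε : 0 < T⁻¹ := inv_pos.2 hT0
  have h8 : 8 * T⁻¹ ≤ 1 := by
    rw [← hTε]; exact mul_le_mul_of_nonneg_right (by linarith) hε.le
  have hgood : (3 + c * m) * (80 * L * T⁻¹) ≤ 1 := by
    rw [← mul_assoc, ← hTε]; exact mul_le_mul_of_nonneg_right (by linarith) hε.le
  have hbad : (1 + c * m) * (Z * (8 * T⁻¹)) ≤ 1 / 2 := by
    have : (1 + c * m) * (Z * 16) * T⁻¹ ≤ 1 :=
      (mul_le_mul_of_nonneg_right (by linarith) hε.le).trans hTε.le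
    linarith
  have hLε : L * T⁻¹ ≤ 1 / 2 := by
    have h1 : 0 ≤ c * m * (80 * L * T⁻¹) := by positivity
    linarith
  obtain ⟨V, hcomm, hV1, hV2⟩ := exists_spin_unitaries hε (by linarith)
  refine ⟨V, c, L * T⁻¹, by positivity, hcomm, fun x n => ?_⟩
  by_cases hx : ∀ l, z x l = E l
  · obtain ⟨W, hW1, hW2⟩ := exists_positive_subspace_of_spin hi hε hc0 (fun j => hV2 j L hL) hgood
      (w := fun l => conj (χ (E l) : ℂ) • (twistedPowers i χ V (z x l) : MatrixProd spinDim))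
      (fun l => by
        rw [conj_smul_twistedPowers, hx l, inv_mul_cancel, Circle.coe_one, one_smul]; rfl) n
    exact ⟨W, hW1.le, fun _ => hW1, hW2⟩
  · obtain ⟨W, hW1, hW2⟩ := exists_positive_subspace_of_scalar (δ := L * T⁻¹) hε hc0 hV1 (hzZ x)
      (d x) (hcS x hx) (by linarith)
      (w := fun l => conj (χ (E l) : ℂ) • (twistedPowers i χ V (z x l) : MatrixProd spinDim))
      (fun l => by rw [conj_smul_twistedPowers]) n
    exact ⟨W, hW1, fun h => absurd h hx, hW2⟩

end LocalForms

/-! ### The main theorem -/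

section Main

open Matrix Module

variable {G : Type u} [Group G]

/-! ### Test elements of block diagonal families -/

section BlockDiagonal

theorem diagElt_pi_apply {X κ B : Type*} [Ring B] [StarRing B] [Algebra ℂ B] [Fintype κ] (c : ℝ)
    (i : κ) (w : X → κ → B) : diagElt c i (fun l x => w x l) = fun x => diagElt c i (w x) := by
  funext x
  have h := map_diagElt (Pi.evalAlgHom ℂ (fun _ : X => B) x) (fun _ => rfl) c i fun l x => w x l
  simpa only [Pi.evalAlgHom_apply] using h

theorem offElt_pi_apply {X κ B : Type*} [Ring B] [StarRing B] [Algebra ℂ B]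
    (i j : κ) (w : X → κ → B) : offElt i j (fun l x => w x l) = fun x => offElt i j (w x) := by
  funext x
  have h := map_offElt (Pi.evalAlgHom ℂ (fun _ : X => B) x) (fun _ => rfl) i j fun l x => w x l
  simpa only [Pi.evalAlgHom_apply] using h

variable {X κ : Type*} [Fintype X] [DecidableEq X] [Nonempty X] (k : ℕ → ℕ) [∀ n, NeZero (k n)]

/-- Block diagonal matrices in the corona. -/
def blockDiagonalHom : (X → MatrixProd k) →ₐ[ℂ] MatrixCorona (blockDim X k) :=
  ((coronaMk (blockDim X k)).comp (blockSeq k)).comp (diagonalAlgHom ℂ)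

theorem blockDiagonalHom_apply (b : X → MatrixProd k) :
    blockDiagonalHom k b = coronaMk (blockDim X k) (blockSeq k (diagonal b)) := rfl

theorem blockDiagonalHom_star (b : X → MatrixProd k) :
    blockDiagonalHom k (star b) = star (blockDiagonalHom k b) := by
  rw [blockDiagonalHom_apply, blockDiagonalHom_apply, star_coronaMk, ← blockSeq_star,
    star_eq_conjTranspose (diagonal b), diagonal_conjTranspose]

theorem diagElt_blockDiagonalHom [Fintype κ] (c : ℝ) (i : κ) (w : X → κ → MatrixProd k) :
    diagElt c i (fun l => blockDiagonalHom k fun x => w x l) =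
      blockDiagonalHom k fun x => diagElt c i (w x) := by
  rw [← map_diagElt (blockDiagonalHom k) (blockDiagonalHom_star k), diagElt_pi_apply]

theorem offElt_blockDiagonalHom (i j : κ) (w : X → κ → MatrixProd k) :
    offElt i j (fun l => blockDiagonalHom k fun x => w x l) =
      blockDiagonalHom k fun x => offElt i j (w x) := by
  rw [← map_offElt (blockDiagonalHom k) (blockDiagonalHom_star k), offElt_pi_apply]

end BlockDiagonal

/-- Sequences of block diagonal matrices with forms positive on subspaces of more than half the
dimension do not have the same class in the corona as commuting sequences. -/
theorem coronaMk_blockSeq_ne_of_commute {X : Type*} [Fintype X] [DecidableEq X] [Nonempty X]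
    {D K : MatrixProd (blockDim X spinDim)} (hD : IsSelfAdjoint D) (hDK : Commute D K)
    {D' K' : X → MatrixProd spinDim}
    (hDD' : coronaMk (blockDim X spinDim) D =
      coronaMk (blockDim X spinDim) (blockSeq spinDim (diagonal D')))
    (hKK' : coronaMk (blockDim X spinDim) K =
      coronaMk (blockDim X spinDim) (blockSeq spinDim (diagonal K')))
    {δ : ℝ} (hδ : 0 < δ)
    (hW : ∀ x n, ∃ W : Submodule ℂ ((Fin (n + 2) → ℂ) × (Fin (n + 2) → ℂ)), n + 2 ≤ finrank ℂ W ∧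
      ∀ p ∈ W, δ * (normSqVec p.1 + normSqVec p.2) ≤ pairForm (D' x n) (K' x n) p.1 p.2)
    {x₀ : X} (hx₀ : ∀ n, ∃ W : Submodule ℂ ((Fin (n + 2) → ℂ) × (Fin (n + 2) → ℂ)),
      n + 2 < finrank ℂ W ∧
      ∀ p ∈ W, δ * (normSqVec p.1 + normSqVec p.2) ≤ pairForm (D' x₀ n) (K' x₀ n) p.1 p.2) :
    False := by
  rw [coronaMk_eq_iff] at hDD' hKK'
  -- A single index at which `D` and `K` are both within `δ / 2` of their block diagonal models is
  -- enough.
  obtain ⟨n, hn1, hn2⟩ := ((hDD'.eventually (gt_mem_nhds (half_pos hδ))).and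
    (hKK'.eventually (gt_mem_nhds (half_pos hδ)))).exists
  let e := blockIndex X spinDim n
  have hnear : ∀ (M : MatrixProd (blockDim X spinDim)) (M' : X → MatrixProd spinDim),
      ‖reindex e.symm e.symm (M n) -
        comp X X (Fin (n + 2)) (Fin (n + 2)) ℂ (diagonal fun x => M' x n)‖ ≤
      ‖M n - blockSeq spinDim (diagonal M') n‖ := by
    intro M M'
    refine le_trans (le_of_eq ?_)
      (norm_reindex_symm_le e (M n - blockSeq spinDim (diagonal M') n))
    congr 1
    have h1 : (diagonal M').map (fun b : MatrixProd spinDim => b n) =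
        diagonal fun x => M' x n := diagonal_map rfl
    rw [blockSeq_apply, blockEquiv_apply, h1]
    ext a b
    simp [e]
  have hWx : ∀ x, ∃ W : Submodule ℂ ((Fin (n + 2) → ℂ) × (Fin (n + 2) → ℂ)),
      (n + 2 ≤ finrank ℂ W ∧ (x = x₀ → n + 2 < finrank ℂ W)) ∧
      ∀ p ∈ W, δ * (normSqVec p.1 + normSqVec p.2) ≤ pairForm (D' x n) (K' x n) p.1 p.2 := by
    intro x
    by_cases hx : x = x₀
    · subst hx
      obtain ⟨W, h1, h2⟩ := hx₀ n
      exact ⟨W, ⟨h1.le, fun _ => h1⟩, h2⟩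
    · obtain ⟨W, h1, h2⟩ := hW x n
      exact ⟨W, ⟨h1, fun h => absurd h hx⟩, h2⟩
  choose W hW1 hW2 using hWx
  have hcomm : Commute (D n) (K n) := congrArg (fun M : MatrixProd _ => M n) hDK.eq
  have hsa : star (D n) = D n := congrArg (fun M : MatrixProd _ => M n) hD.star_eq
  refine not_close_of_finrank_lt (D := reindex e.symm e.symm (D n))
    (K := reindex e.symm e.symm (K n)) ?_ (hcomm.map (reindexAlgEquiv ℂ ℂ e.symm))
    (fun x => D' x n) (fun x => K' x n)
    (lt_of_le_of_lt (add_le_add (hnear D D') (hnear K K')) (by linarith)) W hW2 ?_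
  · change star (reindex e.symm e.symm (D n)) = _
    conv_rhs => rw [← hsa]
    rfl
  · have h1 : Fintype.card X * Fintype.card (Fin (n + 2)) = ∑ _x : X, (n + 2) := by simp
    rw [h1]
    exact Finset.sum_lt_sum (fun x _ => (hW1 x).1) ⟨x₀, Finset.mem_univ _, (hW1 x₀).2 rfl⟩

theorem commute_single_of_commute {a b : G} (h : Commute a b) (c d : ℂ) :
    Commute (MonoidAlgebra.single a c) (MonoidAlgebra.single b d) := by
  rw [commute_iff_eq, MonoidAlgebra.single_mul_single, MonoidAlgebra.single_mul_single, h.eq,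
    mul_comm c]

/-- Since `η` need not be surjective, the basis vectors of `ℤ^m` are replaced by multiples `L` of
them which lie in its image. A lift of the induced representation would send the commuting test
elements of `ℂ[G]` to exactly commuting sequences, against the dimension count. -/
theorem not_matriciallyStable_of_normal (A : Subgroup G) [A.Normal] [A.FiniteIndex] {m : ℕ}
    (hm : 3 ≤ m) {η : A →* Multiplicative (Fin m → ℤ)} (hη : Function.Injective η) {L : ℕ}
    (hL : 1 ≤ L) {e : Fin m → A}
    (he : ∀ l, η (e l) = Multiplicative.ofAdd (Pi.single l (L : ℤ))) :
    ¬ MatriciallyStable G := by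
  classical
  intro hG
  have : Fintype (G ⧸ A) := A.fintypeQuotientOfFiniteIndex
  have hA : ∀ a b : A, a * b = b * a := fun a b => hη (by rw [map_mul, map_mul, mul_comm])
  let i : Fin 3 → Fin m := Fin.castLE hm
  have hi : Function.Injective i := Fin.castLE_injective hm
  obtain ⟨χ, hχ⟩ := exists_injective_circle_character m
  obtain ⟨V, c, δ, hδ, hV, hpos⟩ := exists_unitaries_positive hi hL hχ
    (fun (x : G ⧸ A) l => η (cosetCocycle A (e l) x))
  let ϕ : A → unitary (MatrixProd spinDim) := fun a => twistedPowers i χ V (η a)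
  have hϕ : ∀ a b, coronaMk spinDim (ϕ (a * b) : MatrixProd spinDim) =
      coronaMk spinDim (ϕ a : MatrixProd spinDim) * coronaMk spinDim (ϕ b : MatrixProd spinDim) :=
    fun a b => by
      simp only [ϕ, map_mul η]
      exact map_twistedPowers_mul i χ V (coronaMk spinDim) hV _ _
  -- This normalization makes the scalar factor 1 on the block of the trivial coset, leaving only
  -- the spin part.
  let s : Fin m → ℂ := fun l => conj (χ (Multiplicative.ofAdd (Pi.single l (L : ℤ))) : ℂ)
  let w : G ⧸ A → Fin m → MatrixProd spinDim := fun x l =>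
    s l • (ϕ (cosetCocycle A (e l) x) : MatrixProd spinDim)
  let u : Fin m → MonoidAlgebra ℂ G := fun l => MonoidAlgebra.single (e l : G) (s l)
  have hu : ∀ l, groupAlgebraLift (inducedRep spinDim ϕ hϕ) (u l) =
      blockDiagonalHom spinDim fun x => w x l := by
    intro l
    rw [groupAlgebraLift_single, coe_inducedRep, inducedMatrix_of_mem, ← map_smul, ← map_smul,
      ← diagonal_smul]
    rfl
  obtain ⟨ψ, hψ⟩ := hG (blockDim (G ⧸ A) spinDim) (groupCStarLift (inducedRep spinDim ϕ hϕ))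
  have hψ' : ∀ a : MonoidAlgebra ℂ G, coronaMk (blockDim (G ⧸ A) spinDim)
      (ψ (a : GroupCStarAlgebra G)) = groupAlgebraLift (inducedRep spinDim ϕ hϕ) a := fun a => by
    rw [← groupCStarLift_coe, ← hψ]
    rfl
  have hcomm : ∀ a b : A, Commute (a : G) (b : G) := fun a b => congrArg Subtype.val (hA a b)
  have hDK : Commute (diagElt c (i 2) u) (offElt (i 0) (i 1) u) := by
    refine commute_diagElt_offElt c _ _ _ u
      (fun l l' => commute_single_of_commute (hcomm _ _) _ _) fun l l' => ?_
    rw [star_single]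
    exact commute_single_of_commute (hcomm _ _).inv_right _ _
  have hDsa : IsSelfAdjoint (diagElt c (i 2) u) := isSelfAdjoint_diagElt c _ u
  refine coronaMk_blockSeq_ne_of_commute
    (D := ψ ((diagElt c (i 2) u : MonoidAlgebra ℂ G) : GroupCStarAlgebra G))
    (K := ψ ((offElt (i 0) (i 1) u : MonoidAlgebra ℂ G) : GroupCStarAlgebra G))
    (D' := fun x => diagElt c (i 2) (w x)) (K' := fun x => offElt (i 0) (i 1) (w x))
    (x₀ := ((1 : G) : G ⧸ A)) ?_ ?_ ?_ ?_ hδ ?_ ?_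
  · rw [IsSelfAdjoint, ← map_star, star_coe, hDsa.star_eq]
  · rw [commute_iff_eq, ← map_mul, ← map_mul, ← Completion.coe_mul, ← Completion.coe_mul, hDK.eq]
  · rw [hψ', map_diagElt _ (groupAlgebraLift_star _)]
    simp only [hu]
    exact diagElt_blockDiagonalHom spinDim c (i 2) w
  · rw [hψ', map_offElt _ (groupAlgebraLift_star _)]
    simp only [hu]
    exact offElt_blockDiagonalHom spinDim (i 0) (i 1) w
  · intro x n
    obtain ⟨W, h1, -, h2⟩ := hpos x n
    exact ⟨W, h1, h2⟩
  · intro n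
    obtain ⟨W, -, h1, h2⟩ := hpos ((1 : G) : G ⧸ A) n
    refine ⟨W, h1 fun l => ?_, h2⟩
    -- The representative of the trivial coset need not be 1, but it lies in the abelian group `A`
    -- and so conjugates `e l` trivially.
    have hout : ((1 : G) : G ⧸ A).out ∈ A := by
      have := QuotientGroup.eq.1 (QuotientGroup.out_eq' ((1 : G) : G ⧸ A)).symm
      simpa using this
    have h3 : cosetCocycle A (e l) ((1 : G) : G ⧸ A) = e l := by
      ext
      rw [coe_cosetCocycle_of_mem, (hcomm (e l) ⟨_, hout⟩).eq, inv_mul_cancel_left]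
    rw [h3, he]

end Main

end GroupStability
end

theorem theorem3p14 {G : Type*} [Group G] (hfg : Group.FG G) (m : ℕ) (hm : 3 ≤ m)
    (hG : GroupStability.IsVirtuallyAbelianOfRank G m) :
    ¬ GroupStability.MatriciallyStable G := by
  obtain ⟨H, hH, ⟨θ⟩⟩ := hG
  have : H.normalCore.FiniteIndex := Subgroup.finiteIndex_normalCore H
  let η : H.normalCore →* Multiplicative (Fin m → ℤ) :=
    θ.toMonoidHom.comp (Subgroup.inclusion H.normalCore_le)
  have hη : Function.Injective η :=
    θ.injective.comp (Subgroup.inclusion_injective H.normalCore_le)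
  let b : Fin m → H := fun l => θ.symm (Multiplicative.ofAdd (Pi.single l 1))
  -- Passing to the normal core gives normality at the cost of losing the standard basis; the power
  -- of a basis element by the index of the core lies in the core.
  let e : Fin m → H.normalCore := fun l =>
    ⟨(b l : G) ^ H.normalCore.index, H.normalCore.pow_index_mem (b l : G)⟩
  refine GroupStability.not_matriciallyStable_of_normal H.normalCore hm hη
    (L := H.normalCore.index) (Nat.one_le_iff_ne_zero.2 Subgroup.FiniteIndex.index_ne_zero)
    (e := e) fun l => ?_
  have h1 : Subgroup.inclusion H.normalCore_le (e l) = b l ^ H.normalCore.index :=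
    Subtype.ext rfl
  change θ (Subgroup.inclusion H.normalCore_le (e l)) = _
  rw [h1, map_pow, MulEquiv.apply_symm_apply, ← ofAdd_nsmul]
  congr 1
  ext l'
  by_cases h : l' = l
  · subst h; simp
  · simp [h]
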